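/- Let $n\ge 0$, let $[n]=\{1,\dots,n\}$ and let $s_i=(i,i+1)\in\mathfrak S_n$ for $1\le i<n$. A family of subsets of $[n]$ is noncrossing if it has no distinct members $A,B$ with $a,c\in A$, $b,d\in B$ and $a<b<c<d$. A matching of $[n]$ is a set of pairwise disjoint two-element subsets of $[n]$ (not necessarily covering $[n]$). Let $\mathbb C[NCP(n)_0]$ be the complex vector space with basis the noncrossing set partitions of $[n]$ without singleton blocks, and $\mathbb C[NCM(n)]$ the complex vector space with basis the noncrossing matchings of $[n]$. (1) There is exactly one linear action of $\mathfrak S_n$ on $\mathbb C[NCP(n)_0]$ (Rhoades' skein action) such that for every basis element $\pi$ and every $i$: $s_i\cdot\pi=-\pi$ if $i$ and $i+1$ are in the same block of $\pi$; and if $i,i+1$ are in different blocks $\{i\}\cup A$ and $\{i+1\}\cup B$ (with $A,B\neq\emptyset$), then $s_i\cdot\pi=\pi+\pi_2-\pi_3-\pi_4$, where $\pi_2,\pi_3,\pi_4$ arise from $\pi$ by replacing these two blocks by $\{i,i+1\}$ and $A\cup B$, by $\{i,i+1\}\cup A$ and $B$, and by $\{i,i+1\}\cup B$ and $A$, respectively,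 and where the term $\pi_3$ is omitted if $|B|=1$ and the term $\pi_4$ is omitted if $|A|=1$. (2) There is exactly one linear action of $\mathfrak S_n$ on $\mathbb C[NCM(n)]$ (the sign-twisted Ptolemy action) such that for every basis element $m$ and every $i$: $s_i\cdot m=-s_i(m)$ if the matching $s_i(m)$, obtained by applying $s_i$ to all elements of all pairs, is noncrossing; otherwise $s_i\cdot m=m+m'$, where $m'$ arises from $m$ by replacing the pairs $\{i,a\}$ and $\{i+1,b\}$ that contain $i$ and $i+1$ by $\{i,i+1\}$ and $\{a,b\}$. (3) For a singleton-free noncrossing set partition $\pi$ of $[n]$ let $f_n(\pi)$ be the sum of all matchings of $[n]$ that consist of exactly one pair from each block of $\pi$ (all of them are noncrossing). The linear extension $f_n:\mathbb C[NCP(n)_0]\to\mathbb C[NCM(n)]$ is injective and $\mathfrak S_n$-equivariant for the actions in (1) and (2). -/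

import Mathlib

open Finset Equiv

noncomputable section

/-- A finite family of subsets of `[n]` (modelled by `Fin n`). Set partitions (given by their sets
of blocks) and matchings (given by their sets of pairs) of `[n]` are both such families. -/
abbrev SetFamily (n : ℕ) : Type := Finset (Finset (Fin n))

/-- The complex vector space with basis all families of subsets of `[n]`. The spaces of the theorem
are the subspaces spanned by the appropriate families. -/
abbrev FamilySpace (n : ℕ) : Type := SetFamily n →₀ ℂ

/-- The basis vector of a family. -/
abbrev basisVec {n : ℕ} (P : SetFamily n) : FamilySpace n := Finsupp.single P 1

/-- No two distinct members `A`, `B` contain `a, c ∈ A`, `b, d ∈ B` with `a < b < c < d`. -/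
def Noncrossing {n : ℕ} (P : SetFamily n) : Prop :=
  ∀ A ∈ P, ∀ B ∈ P, A ≠ B →
    ¬ ∃ a ∈ A, ∃ b ∈ B, ∃ c ∈ A, ∃ d ∈ B, a < b ∧ b < c ∧ c < d

/-- `P` is the set of blocks of a set partition of `[n]`. -/
def IsSetPartition {n : ℕ} (P : SetFamily n) : Prop :=
  ∃ π : Finpartition (univ : Finset (Fin n)), π.parts = P

/-- No member is a singleton. -/
def SingletonFree {n : ℕ} (P : SetFamily n) : Prop := ∀ B ∈ P, B.card ≠ 1

/-- `m` is a (not necessarily perfect) matching: a collection of disjoint two-element sets. -/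
def IsMatching {n : ℕ} (m : SetFamily n) : Prop :=
  (∀ e ∈ m, e.card = 2) ∧ (m : Set (Finset (Fin n))).PairwiseDisjoint id

/-- The span of the singleton-free noncrossing set partitions of `[n]`. -/
def NCPZeroSpace (n : ℕ) : Submodule ℂ (FamilySpace n) :=
  Finsupp.supported ℂ ℂ {P | IsSetPartition P ∧ Noncrossing P ∧ SingletonFree P}

/-- The span of the noncrossing matchings of `[n]`. -/
def NCMSpace (n : ℕ) : Submodule ℂ (FamilySpace n) :=
  Finsupp.supported ℂ ℂ {m | IsMatching m ∧ Noncrossing m}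

/-- Apply the permutation `w` to every element of every member of the family. -/
def permute {n : ℕ} (w : Perm (Fin n)) (P : SetFamily n) : SetFamily n :=
  P.image fun B => B.image w

/-- The sign-twisted permutation action on families: `w ∘ P = sign(w) · w(P)`. -/
def signedPermute {n : ℕ} (w : Perm (Fin n)) (P : SetFamily n) : FamilySpace n :=
  ((Perm.sign w : ℤ) : ℂ) • basisVec (permute w P)

/-- The member of `P` containing `x` (when the members of `P` are disjoint and one of them
contains `x`; it is empty if no member contains `x`). -/
def blockOf {n : ℕ} (P : SetFamily n) (x : Fin n) : Finset (Fin n) :=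
  (P.filter fun B => x ∈ B).sup id

/-- Replace the blocks of `x` and `y` in `P` by the sets `C` and `D`. -/
def replaceBlocks {n : ℕ} (P : SetFamily n) (x y : Fin n) (C D : Finset (Fin n)) : SetFamily n :=
  (P \ {blockOf P x, blockOf P y}) ∪ {C, D}

open Classical in
/-- The Ptolemy action of the transposition of `x = i` and `y = i + 1` on a noncrossing matching:
`s ∘ m` if it is noncrossing; otherwise `m + m'`, where `m'` arises from `m` by replacing
`{i, a}`, `{i+1, b}` by `{i, i+1}`, `{a, b}`. -/
def ptolemyStep {n : ℕ} (x y : Fin n) (m : SetFamily n) : FamilySpace n :=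
  if Noncrossing (permute (swap x y) m) then signedPermute (swap x y) m
  else basisVec m +
    basisVec (replaceBlocks m x y {x, y} ((blockOf m x).erase x ∪ (blockOf m y).erase y))

/-- The skein action of the transposition of `x = i` and `y = i + 1` on a noncrossing set
partition `P`. In the last case `P` has distinct blocks `{i} ∪ A` and `{i+1} ∪ B` with `A`, `B`
nonempty, and exchanging `i` and `i + 1` creates a crossing, which is resolved into `P` itself,
plus the partition with `{i, i+1}` and `A ∪ B`, minus the one with `{i, i+1} ∪ A` and `B`
(omitted if `B` is a singleton), minus the one with `{i, i+1} ∪ B` and `A` (omitted if `A` is a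
singleton). -/
def skeinStep {n : ℕ} (x y : Fin n) (P : SetFamily n) : FamilySpace n :=
  let A := (blockOf P x).erase x
  let B := (blockOf P y).erase y
  if blockOf P x = blockOf P y then - basisVec P
  else if blockOf P x = {x} ∨ blockOf P y = {y} then - basisVec (permute (swap x y) P)
  else basisVec P + basisVec (replaceBlocks P x y {x, y} (A ∪ B))
    - (if 2 ≤ B.card then basisVec (replaceBlocks P x y ({x, y} ∪ A) B) else 0)
    - (if 2 ≤ A.card then basisVec (replaceBlocks P x y ({x, y} ∪ B) A) else 0)

/-- `ρ` is the skein action of the symmetric group on the span of the singleton-free noncrossing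
set partitions: every adjacent transposition acts by the skein rule. -/
def IsSkeinAction {n : ℕ} (ρ : Representation ℂ (Perm (Fin n)) (NCPZeroSpace n)) : Prop :=
  ∀ x y : Fin n, (y : ℕ) = x + 1 → ∀ v : NCPZeroSpace n,
    (ρ (swap x y) v : FamilySpace n) =
      Finsupp.linearCombination ℂ (skeinStep x y) (v : FamilySpace n)

/-- `τ` is the Ptolemy action of the symmetric group on the span of the noncrossing matchings:
every adjacent transposition acts by the Ptolemy rule. -/
def IsPtolemyAction {n : ℕ} (τ : Representation ℂ (Perm (Fin n)) (NCMSpace n)) : Prop :=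
  ∀ x y : Fin n, (y : ℕ) = x + 1 → ∀ v : NCMSpace n,
    (τ (swap x y) v : FamilySpace n) =
      Finsupp.linearCombination ℂ (ptolemyStep x y) (v : FamilySpace n)

/-- `m` is a matching consisting of exactly one pair from each block of `P`. -/
def PicksOnePair {n : ℕ} (P m : SetFamily n) : Prop :=
  IsMatching m ∧ (∀ e ∈ m, ∃ B ∈ P, e ⊆ B) ∧ (∀ B ∈ P, ∃! e, e ∈ m ∧ e ⊆ B)

open Classical in
/-- The sum of all matchings that consist of exactly one pair from each block of `P`. -/
def pairSum {n : ℕ} (P : SetFamily n) : FamilySpace n :=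
  ∑ m ∈ (univ : Finset (SetFamily n)).filter (PicksOnePair P), basisVec m

theorem PicksOnePair.noncrossing {n : ℕ} {P m : SetFamily n} (hP : Noncrossing P)
    (h : PicksOnePair P m) : Noncrossing m := by
  rintro e he e' he' hne ⟨a, ha, b, hb, c, hc, d, hd, h1, h2, h3⟩
  obtain ⟨B, hB, heB⟩ := h.2.1 e he
  obtain ⟨B', hB', heB'⟩ := h.2.1 e' he'
  by_cases hBB : B = B'
  · subst hBB
    exact hne ((h.2.2 B hB).unique ⟨he, heB⟩ ⟨he', heB'⟩)
  · exact hP B hB B' hB' hBB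
      ⟨a, heB ha, b, heB' hb, c, heB hc, d, heB' hd, h1, h2, h3⟩

theorem linearCombination_pairSum_mem {n : ℕ} (v : FamilySpace n) (hv : v ∈ NCPZeroSpace n) :
    Finsupp.linearCombination ℂ (pairSum (n := n)) v ∈ NCMSpace n := by
  classical
  rw [Finsupp.linearCombination_apply]
  refine Submodule.sum_mem _ fun P hP => Submodule.smul_mem _ _ ?_
  have hP' := (Finsupp.mem_supported ℂ v).1 hv hP
  refine Submodule.sum_mem _ fun m hm => ?_
  have hm' : PicksOnePair P m := (Finset.mem_filter.1 hm).2
  exact Finsupp.single_mem_supported ℂ 1 ⟨hm'.1, hm'.noncrossing hP'.2.1⟩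

/-- The linear map sending a singleton-free noncrossing set partition to the sum of all matchings
that consist of exactly one pair from each of its blocks. -/
def skeinEmbedding (n : ℕ) : NCPZeroSpace n →ₗ[ℂ] NCMSpace n :=
  (Finsupp.linearCombination ℂ (pairSum (n := n))).restrict linearCombination_pairSum_mem

end

/-!
# The skein action and the Ptolemy action inside an exterior algebra

Both representations are found inside an honest permutation representation of the symmetric group.
Take the exterior algebra on two odd generators `x_a`, `y_a` for each point `a` of `[n]`, with the
symmetric group permuting the points and twisted by the sign. A set `B` of points gives the central
element `q(B) = ∑ x_a ∧ y_b`, summed over ordered pairs of distinct elements of `B`, and a family of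
sets is realized by the product of the `q(B)` over its members. A permutation `w` sends the
realization of `P` to `sign(w)` times the realization of `w(P)`.

Since odd generators anticommute, the elements `q(ab) = x_a y_b + x_b y_a` are symmetric in `a`, `b`
and satisfy `q(ac) q(bd) + q(ab) q(cd) + q(ad) q(bc) = 0`. Summing this relation over two blocks
(`blockElement_resolution`) yields the skein rule; the Ptolemy rule is the special case in which both
blocks are pairs, because `q` vanishes on singletons. Since `q(B)` is the sum of `q(e)` over the pairs
`e ⊆ B`, expanding the product shows that a partition and the sum of its matchings have the same
realization (`realizationMap_pairSum`).

Two triangularity arguments give the required independence. For matchings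
(`eq_zero_of_realizationMap_eq_zero`), a noncrossing matching is determined by the sets of smaller
and of larger elements of its pairs, and the part of a realization that involves only the `x_a` and
`y_b` at these points singles it out, up to matchings with a smaller sum of openers. For partitions
(`eq_zero_of_pairSum_eq_zero`), a noncrossing partition without singletons is determined by the
matching formed by the smallest and the largest elements of its blocks, which is the widest of its
matchings.

Thus the spans embed into the exterior algebra, and the two rules describe how the adjacent
transpositions act on the images. As these generate the symmetric group, the images are
subrepresentations (`existsUnique_representation`), and the embedding of partitions into matchings
is compatible with the two embeddings into the exterior algebra, hence equivariant and injective.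
-/

/-! ### Central bivectors in the exterior algebra -/

section Grassmann

variable {n : ℕ} {M N : Type*} [AddCommGroup M] [Module ℂ M] [AddCommGroup N] [Module ℂ N]

/-- The product `u ∧ v`, as an element of the centre of the exterior algebra. Working in the centre,
a commutative ring, makes products over finsets of such elements available. -/
noncomputable def bivector (u v : M) : Subalgebra.center ℂ (ExteriorAlgebra ℂ M) :=
  ⟨ExteriorAlgebra.ι ℂ u * ExteriorAlgebra.ι ℂ v, Subalgebra.mem_center_iff.2 fun b => by
    induction b using ExteriorAlgebra.induction with
    | algebraMap r => exact Algebra.commutes r _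
    | ι w =>
      have h1 := eq_neg_of_add_eq_zero_left (ExteriorAlgebra.ι_add_mul_swap (R := ℂ) w u)
      have h2 := eq_neg_of_add_eq_zero_left (ExteriorAlgebra.ι_add_mul_swap (R := ℂ) w v)
      rw [← mul_assoc, h1, neg_mul, mul_assoc, h2, mul_neg, neg_neg, mul_assoc]
    | mul a b ha hb => rw [mul_assoc, hb, ← mul_assoc, ha, mul_assoc]
    | add a b ha hb => rw [add_mul, ha, hb, mul_add]⟩

theorem bivector_mul_bivector_swap (u v u' v' : M) :
    bivector u v * bivector u' v' = -(bivector u v' * bivector u' v) := by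
  apply Subtype.ext
  change ExteriorAlgebra.ι ℂ u * ExteriorAlgebra.ι ℂ v *
      (ExteriorAlgebra.ι ℂ u' * ExteriorAlgebra.ι ℂ v') =
    -(ExteriorAlgebra.ι ℂ u * ExteriorAlgebra.ι ℂ v' *
      (ExteriorAlgebra.ι ℂ u' * ExteriorAlgebra.ι ℂ v))
  have h1 := eq_neg_of_add_eq_zero_left (ExteriorAlgebra.ι_add_mul_swap (R := ℂ) v u')
  have h2 := eq_neg_of_add_eq_zero_left (ExteriorAlgebra.ι_add_mul_swap (R := ℂ) v' u')
  have h3 := eq_neg_of_add_eq_zero_left (ExteriorAlgebra.ι_add_mul_swap (R := ℂ) v v')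
  rw [mul_assoc, mul_assoc, ← mul_assoc _ (ExteriorAlgebra.ι ℂ u'),
    ← mul_assoc _ (ExteriorAlgebra.ι ℂ u'), h1, h2]
  simp only [neg_mul, mul_neg, mul_assoc, h3, neg_neg]

/-- For vectors `x a`, `y a` indexed by `a ∈ [n]`, the element `∑ x a ∧ y b` over all ordered pairs
of distinct `a, b ∈ B`. It vanishes on singletons, and on a general `B` it is the sum of its values
on the two-element subsets of `B`. -/
noncomputable def blockElement (x y : Fin n → M) (B : Finset (Fin n)) :
    Subalgebra.center ℂ (ExteriorAlgebra ℂ M) :=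
  ∑ p ∈ B.offDiag, bivector (x p.1) (y p.2)

/-- The product of the block elements of the members of a family. -/
noncomputable def familyElement (x y : Fin n → M) (P : SetFamily n) :
    Subalgebra.center ℂ (ExteriorAlgebra ℂ M) :=
  ∏ B ∈ P, blockElement x y B

theorem map_blockElement (f : M →ₗ[ℂ] N) (x y : Fin n → M) (B : Finset (Fin n)) :
    ExteriorAlgebra.map f (blockElement x y B : ExteriorAlgebra ℂ M) =
      (blockElement (f ∘ x) (f ∘ y) B : ExteriorAlgebra ℂ N) := by
  simp [blockElement, bivector]

theorem map_familyElement (f : M →ₗ[ℂ] N) (x y : Fin n → M) (P : SetFamily n) :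
    ExteriorAlgebra.map f (familyElement x y P : ExteriorAlgebra ℂ M) =
      (familyElement (f ∘ x) (f ∘ y) P : ExteriorAlgebra ℂ N) := by
  classical
  unfold familyElement
  induction P using Finset.induction_on with
  | empty => simp
  | insert B P hB ih =>
    rw [prod_insert hB, prod_insert hB, MulMemClass.coe_mul, MulMemClass.coe_mul, map_mul, ih,
      map_blockElement]

theorem blockElement_image (x y : Fin n → M) (w : Perm (Fin n)) (B : Finset (Fin n)) :
    blockElement x y (B.image w) = blockElement (x ∘ w) (y ∘ w) B := by
  unfold blockElement
  refine (sum_nbij (fun p => (w p.1, w p.2)) ?_ ?_ ?_ ?_).symm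
  · rintro ⟨a, b⟩ h
    simp only [mem_offDiag, mem_image] at h ⊢
    exact ⟨⟨a, h.1, rfl⟩, ⟨b, h.2.1, rfl⟩, fun e => h.2.2 (w.injective e)⟩
  · rintro ⟨a, b⟩ - ⟨c, d⟩ - h
    simpa using h
  · rintro ⟨a, b⟩ h
    simp only [coe_offDiag, Set.mem_offDiag, mem_coe, mem_image] at h
    obtain ⟨⟨a, ha, rfl⟩, ⟨b, hb, rfl⟩, hab⟩ := h
    exact ⟨(a, b), by simpa using ⟨ha, hb, fun e => hab (by rw [e])⟩, rfl⟩
  · intros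
    rfl

theorem familyElement_permute (x y : Fin n → M) (w : Perm (Fin n)) (P : SetFamily n) :
    familyElement x y (permute w P) = familyElement (x ∘ w) (y ∘ w) P := by
  unfold familyElement permute
  rw [prod_image fun A _ B _ h => image_injective w.injective h]
  exact prod_congr rfl fun B _ => blockElement_image x y w B

theorem blockElement_union (x y : Fin n → M) {A B : Finset (Fin n)} (h : Disjoint A B) :
    blockElement x y (A ∪ B) = blockElement x y A + blockElement x y B +
      ∑ a ∈ A, ∑ b ∈ B, (bivector (x a) (y b) + bivector (x b) (y a)) := by
  have hd : ∀ {a b}, a ∈ A → b ∈ B → a ≠ b := fun ha hb e => disjoint_left.1 h ha (e ▸ hb)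
  unfold blockElement
  rw [offDiag_union h, sum_union, sum_union, sum_union, sum_product, sum_product_right (s := B)]
  · simp only [sum_add_distrib]
    abel
  · rw [disjoint_left]
    rintro ⟨a, b⟩ h1 h2
    simp only [mem_offDiag] at h1 h2
    exact hd h1.1 h2.1 rfl
  · rw [disjoint_left]
    rintro ⟨a, b⟩ h1 h2
    simp only [mem_offDiag, mem_union, mem_product] at h1 h2
    rcases h1 with h1 | h1
    · exact hd h1.2.1 h2.2 rfl
    · exact hd h2.1 h1.1 rfl
  · rw [disjoint_left]
    rintro ⟨a, b⟩ h1 h2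
    simp only [mem_offDiag, mem_union, mem_product] at h1 h2
    rcases h1 with (h1 | h1) | h1
    · exact hd h1.1 h2.1 rfl
    · exact hd h2.2 h1.2.1 rfl
    · exact hd h1.1 h2.1 rfl

theorem blockElement_singleton (x y : Fin n → M) (a : Fin n) : blockElement x y {a} = 0 := by
  simp [blockElement]

theorem blockElement_insert (x y : Fin n → M) {i : Fin n} {A : Finset (Fin n)} (h : i ∉ A) :
    blockElement x y (insert i A) = blockElement x y A +
      ∑ a ∈ A, (bivector (x i) (y a) + bivector (x a) (y i)) := by
  rw [insert_eq, blockElement_union x y (disjoint_singleton_left.2 h), blockElement_singleton,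
    zero_add, sum_singleton]

/-- The relation between symmetrized products `z a b + z b a` that follows from the antisymmetry
`z a b * z c d = -(z a d * z c b)`. -/
theorem symmetrized_plucker {R α : Type*} [CommRing R] (z : α → α → R)
    (hz : ∀ a b c d, z a b * z c d = -(z a d * z c b)) (i j a b : α) :
    (z j a + z a j) * (z i b + z b i) + (z i a + z a i) * (z j b + z b j) +
      (z i j + z j i) * (z a b + z b a) = 0 := by
  linear_combination hz j a i b + hz j a b i + hz a j i b + hz a j b i + hz i a b j + hz a i j b

theorem symmetrized_plucker_sum {R α : Type*} [CommRing R] (z : α → α → R)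
    (hz : ∀ a b c d, z a b * z c d = -(z a d * z c b)) (i j : α) (A B : Finset α) :
    (∑ a ∈ A, (z j a + z a j)) * (∑ b ∈ B, (z i b + z b i)) +
      (∑ a ∈ A, (z i a + z a i)) * (∑ b ∈ B, (z j b + z b j)) +
      (z i j + z j i) * ∑ a ∈ A, ∑ b ∈ B, (z a b + z b a) = 0 := by
  rw [sum_mul_sum, sum_mul_sum, mul_sum, ← sum_add_distrib, ← sum_add_distrib]
  refine sum_eq_zero fun a _ => ?_
  rw [mul_sum, ← sum_add_distrib, ← sum_add_distrib]
  exact sum_eq_zero fun b _ => symmetrized_plucker z hz i j a b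

theorem resolution_of_plucker {R : Type*} [CommRing R] {qA qB iA jA iB jB ij AB : R}
    (h : jA * iB + iA * jB + ij * AB = 0) :
    -((qA + jA) * (qB + iB)) = (qA + iA) * (qB + jB) + ij * (qA + qB + AB)
      - (qA + jA + (ij + iA)) * qB - (qB + jB + (ij + iB)) * qA := by
  linear_combination -h

theorem mul_four_term {R : Type*} [CommRing R] (r : R) {a b c d e : R} (h : -a = b + c - d - e) :
    -(r * a) = r * b + r * c - r * d - r * e := by
  linear_combination r * h

/-- The resolution of a crossing: the Plücker-type relation
`q(ia) q(jb) + q(ib) q(ja) + q(ij) q(ab) = 0` between the elements `q` of two-element sets, summed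
over `a ∈ A` and `b ∈ B`. -/
theorem blockElement_resolution (x y : Fin n → M) {i j : Fin n} {A B : Finset (Fin n)}
    (hij : i ≠ j) (hAB : Disjoint A B) (hiA : i ∉ A) (hjA : j ∉ A) (hiB : i ∉ B) (hjB : j ∉ B) :
    -(blockElement x y (insert j A) * blockElement x y (insert i B)) =
      blockElement x y (insert i A) * blockElement x y (insert j B)
        + blockElement x y {i, j} * blockElement x y (A ∪ B)
        - blockElement x y ({i, j} ∪ A) * blockElement x y B
        - blockElement x y ({i, j} ∪ B) * blockElement x y A := by
  have e : ∀ C : Finset (Fin n), {i, j} ∪ C = insert i (insert j C) := by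
    intro C; ext; simp
  have hi : ∀ {C : Finset (Fin n)}, i ∉ C → i ∉ insert j C := by
    intro C h; simp [hij, h]
  rw [e, e, blockElement_insert x y (hi hiA), blockElement_insert x y (hi hiB),
    blockElement_insert x y hiA, blockElement_insert x y hjA, blockElement_insert x y hiB,
    blockElement_insert x y hjB, blockElement_union x y hAB, sum_insert hjA, sum_insert hjB,
    blockElement_insert x y (A := {j}) (i := i) (by simpa using hij), blockElement_singleton,
    sum_singleton, zero_add]
  exact resolution_of_plucker (symmetrized_plucker_sum (fun a b => bivector (x a) (y b))
    (fun a b c d => bivector_mul_bivector_swap (x a) (y b) (x c) (y d)) i j A B)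

end Grassmann

/-! ### Noncrossing families and the replacement of two blocks -/

section Families

variable {n : ℕ}

theorem isSetPartition_iff {P : SetFamily n} :
    IsSetPartition P ↔ ∅ ∉ P ∧ (P : Set (Finset (Fin n))).PairwiseDisjoint id ∧
      ∀ z, ∃ B ∈ P, z ∈ B := by
  constructor
  · rintro ⟨π, rfl⟩
    exact ⟨π.bot_notMem, π.disjoint, fun z => π.exists_mem (mem_univ z)⟩
  · rintro ⟨h0, hd, hc⟩
    refine ⟨⟨P, supIndep_iff_pairwiseDisjoint.2 hd, ?_, h0⟩, rfl⟩
    refine eq_univ_of_forall fun z => ?_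
    obtain ⟨B, hB, hz⟩ := hc z
    exact mem_sup.2 ⟨B, hB, hz⟩

/-- Members of a pairwise disjoint family that share an element are equal. -/
theorem eq_of_mem_of_mem {P : SetFamily n} (hd : (P : Set (Finset (Fin n))).PairwiseDisjoint id)
    {E F : Finset (Fin n)} (hE : E ∈ P) (hF : F ∈ P) {z : Fin n} (hz : z ∈ E) (hz' : z ∈ F) :
    E = F :=
  hd.elim_finset hE hF z hz hz'

theorem blockOf_eq {P : SetFamily n} (hd : (P : Set (Finset (Fin n))).PairwiseDisjoint id)
    {E : Finset (Fin n)} (hE : E ∈ P) {z : Fin n} (hz : z ∈ E) : blockOf P z = E := by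
  have : P.filter (fun B => z ∈ B) = {E} := by
    ext B
    simp only [mem_filter, mem_singleton]
    exact ⟨fun h => eq_of_mem_of_mem hd h.1 hE h.2 hz, fun h => h ▸ ⟨hE, hz⟩⟩
  rw [blockOf, this, sup_singleton, id]

/-- No two elements of `E` are separated by an interval with end points in `F`. For disjoint sets
this says that `E` and `F` do not cross, in either order; unlike the condition of `Noncrossing` it
treats all positions of the four points alike. -/
def NoncrossingPair (E F : Finset (Fin n)) : Prop :=
  ∀ b ∈ F, ∀ d ∈ F, ∀ u ∈ E, ∀ v ∈ E, b < u → u < d → b < v ∧ v < d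

theorem NoncrossingPair.symm {E F : Finset (Fin n)} (hd : Disjoint E F)
    (h : NoncrossingPair E F) : NoncrossingPair F E := by
  intro u hu v hv b hb d hd' h1 h2
  have hud : u ≠ d := fun e => disjoint_left.1 hd hu (e ▸ hd')
  have hvd : v ≠ d := fun e => disjoint_left.1 hd hv (e ▸ hd')
  constructor
  · by_contra h3
    have := (h d hd' b hb u hu v hv (by grind) h1).2
    grind
  · by_contra h3
    have := (h b hb d hd' v hv u hu h2 (by grind)).1
    grind

theorem NoncrossingPair.mono {E E' F : Finset (Fin n)} (hE : E' ⊆ E) (h : NoncrossingPair E F) :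
    NoncrossingPair E' F :=
  fun b hb d hd u hu v hv => h b hb d hd u (hE hu) v (hE hv)

theorem NoncrossingPair.mono_right {E F F' : Finset (Fin n)} (hF : F' ⊆ F)
    (h : NoncrossingPair E F) : NoncrossingPair E F' :=
  fun b hb d hd => h b (hF hb) d (hF hd)

theorem noncrossingPair_singleton (x : Fin n) (F : Finset (Fin n)) : NoncrossingPair {x} F := by
  intro b _ d _ u hu v hv h1 h2
  rw [mem_singleton.1 hv, ← mem_singleton.1 hu]
  exact ⟨h1, h2⟩

theorem noncrossing_iff {P : SetFamily n}
    (hd : (P : Set (Finset (Fin n))).PairwiseDisjoint id) :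
    Noncrossing P ↔ ∀ E ∈ P, ∀ F ∈ P, E ≠ F → NoncrossingPair E F := by
  constructor
  · intro h E hE F hF hEF b hb d hd' u hu v hv h1 h2
    have hvb : v ≠ b := fun e => hEF (eq_of_mem_of_mem hd hE hF hv (e ▸ hb))
    have hvd : v ≠ d := fun e => hEF (eq_of_mem_of_mem hd hE hF hv (e ▸ hd'))
    constructor
    · by_contra h3
      exact h E hE F hF hEF ⟨v, hv, b, hb, u, hu, d, hd', by grind, h1, h2⟩
    · by_contra h3
      exact h F hF E hE hEF.symm ⟨b, hb, u, hu, d, hd', v, hv, h1, h2, by grind⟩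
  · rintro h A hA B hB hAB ⟨a, ha, b, hb, c, hc, d, hd', h1, h2, h3⟩
    exact lt_asymm h1 (h A hA B hB hAB b hb d hd' c hc a ha h2 h3).1

/-- Adjacent points outside `G` lie on the same side of every interval with end points in `G`, so
sets containing them can be merged without crossing `G`. -/
theorem NoncrossingPair.union {x y : Fin n} (hxy : (y : ℕ) = x + 1) {E F G : Finset (Fin n)}
    (hE : NoncrossingPair E G) (hF : NoncrossingPair F G) (hx : x ∈ E) (hy : y ∈ F) (hxG : x ∉ G)
    (hyG : y ∉ G) : NoncrossingPair (E ∪ F) G := by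
  intro b hb d hd
  have h1 : x ≠ b := fun e => hxG (e ▸ hb)
  have h2 : x ≠ d := fun e => hxG (e ▸ hd)
  have h3 : y ≠ b := fun e => hyG (e ▸ hb)
  have h4 : y ≠ d := fun e => hyG (e ▸ hd)
  have key : (b < x ∧ x < d) ↔ (b < y ∧ y < d) := by
    simp only [Fin.lt_def, ne_eq, Fin.ext_iff] at h1 h2 h3 h4 ⊢
    omega
  have all : ∀ u ∈ E ∪ F, (b < u ∧ u < d) ↔ (b < x ∧ x < d) := by
    intro u hu
    rcases mem_union.1 hu with hu | hu
    · exact ⟨fun h => hE b hb d hd u hu x hx h.1 h.2, fun h => hE b hb d hd x hx u hu h.1 h.2⟩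
    · rw [key]
      exact ⟨fun h => hF b hb d hd u hu y hy h.1 h.2, fun h => hF b hb d hd y hy u hu h.1 h.2⟩
  intro u hu v hv h5 h6
  exact (all v hv).2 ((all u hu).1 ⟨h5, h6⟩)

/-- The exchange of adjacent points preserves the order of `u` and `v` unless it exchanges them. -/
theorem lt_of_swap_lt {x y : Fin n} (hxy : (y : ℕ) = x + 1) {u v : Fin n}
    (huv : ¬(u = y ∧ v = x)) (h : swap x y u < swap x y v) : u < v := by
  rw [swap_apply_def, swap_apply_def] at h
  simp only [Fin.lt_def, Fin.ext_iff] at h huv ⊢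
  split_ifs at h <;> omega

theorem exists_blocks_of_permute_crossing {x y : Fin n} (hxy : (y : ℕ) = x + 1) {P : SetFamily n}
    (h : Noncrossing P) (h' : ¬Noncrossing (permute (swap x y) P)) :
    ∃ E ∈ P, ∃ F ∈ P, E ≠ F ∧ x ∈ E ∧ y ∈ F := by
  by_contra! hno
  apply h'
  rintro A' hA B' hB hAB ⟨a', ha', b', hb', c', hc', d', hd', h1, h2, h3⟩
  obtain ⟨E, hE, rfl⟩ := mem_image.1 hA
  obtain ⟨F, hF, rfl⟩ := mem_image.1 hB
  obtain ⟨a, ha, rfl⟩ := mem_image.1 ha'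
  obtain ⟨b, hb, rfl⟩ := mem_image.1 hb'
  obtain ⟨c, hc, rfl⟩ := mem_image.1 hc'
  obtain ⟨d, hd, rfl⟩ := mem_image.1 hd'
  have hEF : E ≠ F := fun e => hAB (by rw [e])
  have key : ∀ u ∈ E, ∀ v ∈ F, ¬(u = y ∧ v = x) := by
    rintro u hu v hv ⟨rfl, rfl⟩
    exact hno F hF E hE hEF.symm hv hu
  have key' : ∀ u ∈ F, ∀ v ∈ E, ¬(u = y ∧ v = x) := by
    rintro u hu v hv ⟨rfl, rfl⟩
    exact hno E hE F hF hEF hv hu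
  exact h E hE F hF hEF ⟨a, ha, b, hb, c, hc, d, hd, lt_of_swap_lt hxy (key a ha b hb) h1,
    lt_of_swap_lt hxy (key' b hb c hc) h2, lt_of_swap_lt hxy (key c hc d hd) h3⟩

/-- The sets `C` and `D` are a redistribution of the elements of two distinct blocks `E ∋ x` and
`F ∋ y` of the family `P` of disjoint nonempty sets. -/
structure Redistribution (P : SetFamily n) (x y : Fin n) (E F C D : Finset (Fin n)) : Prop where
  disjoint : (P : Set (Finset (Fin n))).PairwiseDisjoint id
  empty_notMem : ∅ ∉ P
  left_mem : E ∈ P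
  right_mem : F ∈ P
  ne : E ≠ F
  mem_left : x ∈ E
  mem_right : y ∈ F
  nonempty_left : C.Nonempty
  nonempty_right : D.Nonempty
  disjoint_new : Disjoint C D
  union_eq : C ∪ D = E ∪ F

namespace Redistribution

variable {P : SetFamily n} {x y : Fin n} {E F C D : Finset (Fin n)}

theorem replaceBlocks_eq (h : Redistribution P x y E F C D) :
    replaceBlocks P x y C D = (P \ {E, F}) ∪ {C, D} := by
  rw [replaceBlocks, blockOf_eq h.disjoint h.left_mem h.mem_left,
    blockOf_eq h.disjoint h.right_mem h.mem_right]

theorem mem_iff (h : Redistribution P x y E F C D) {B : Finset (Fin n)} :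
    B ∈ replaceBlocks P x y C D ↔ (B ∈ P ∧ B ≠ E ∧ B ≠ F) ∨ B = C ∨ B = D := by
  rw [h.replaceBlocks_eq]
  simp
  tauto

theorem new_ne (h : Redistribution P x y E F C D) : C ≠ D := by
  intro e
  have := h.disjoint_new
  rw [← e, disjoint_self] at this
  exact h.nonempty_left.ne_empty this

/-- The other blocks are disjoint from the two that are replaced. -/
theorem disjoint_rest (h : Redistribution P x y E F C D) {B : Finset (Fin n)} (hB : B ∈ P)
    (hE : B ≠ E) (hF : B ≠ F) : Disjoint (C ∪ D) B := by
  rw [h.union_eq, disjoint_union_left]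
  exact ⟨h.disjoint h.left_mem hB hE.symm, h.disjoint h.right_mem hB hF.symm⟩

theorem pairwiseDisjoint (h : Redistribution P x y E F C D) :
    (replaceBlocks P x y C D : Set (Finset (Fin n))).PairwiseDisjoint id := by
  intro B hB B' hB' hne
  rw [mem_coe, h.mem_iff] at hB hB'
  have hr : ∀ {G}, G ∈ P ∧ G ≠ E ∧ G ≠ F → Disjoint C G ∧ Disjoint D G := fun hG =>
    disjoint_union_left.1 (h.disjoint_rest hG.1 hG.2.1 hG.2.2)
  change Disjoint B B'
  rcases hB with hB | rfl | rfl <;> rcases hB' with hB' | rfl | rfl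
  · exact h.disjoint hB.1 hB'.1 hne
  · exact (hr hB).1.symm
  · exact (hr hB).2.symm
  · exact (hr hB').1
  · exact absurd rfl hne
  · exact h.disjoint_new
  · exact (hr hB').2
  · exact h.disjoint_new.symm
  · exact absurd rfl hne

theorem isSetPartition (h : Redistribution P x y E F C D) (hP : IsSetPartition P) :
    IsSetPartition (replaceBlocks P x y C D) := by
  rw [isSetPartition_iff] at hP ⊢
  refine ⟨fun h0 => ?_, h.pairwiseDisjoint, fun z => ?_⟩
  · rcases h.mem_iff.1 h0 with h0 | h0 | h0
    · exact hP.1 h0.1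
    · exact h.nonempty_left.ne_empty h0.symm
    · exact h.nonempty_right.ne_empty h0.symm
  · obtain ⟨B, hB, hz⟩ := hP.2.2 z
    by_cases hBEF : B ≠ E ∧ B ≠ F
    · exact ⟨B, h.mem_iff.2 (Or.inl ⟨hB, hBEF⟩), hz⟩
    · have : z ∈ C ∪ D := by
        rw [h.union_eq, mem_union]
        by_cases hBE : B = E
        · exact Or.inl (hBE ▸ hz)
        · exact Or.inr ((not_not.1 fun hBF => hBEF ⟨hBE, hBF⟩ : B = F) ▸ hz)
      rcases mem_union.1 this with hz | hz
      · exact ⟨C, h.mem_iff.2 (Or.inr (Or.inl rfl)), hz⟩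
      · exact ⟨D, h.mem_iff.2 (Or.inr (Or.inr rfl)), hz⟩

theorem noncrossing (h : Redistribution P x y E F C D) (hxy : (y : ℕ) = x + 1)
    (hP : Noncrossing P) (hCD : NoncrossingPair C D) :
    Noncrossing (replaceBlocks P x y C D) := by
  rw [noncrossing_iff h.disjoint] at hP
  rw [noncrossing_iff h.pairwiseDisjoint]
  have hr : ∀ {G}, G ∈ P ∧ G ≠ E ∧ G ≠ F → NoncrossingPair (C ∪ D) G := by
    intro G hG
    rw [h.union_eq]
    refine NoncrossingPair.union hxy (hP E h.left_mem G hG.1 hG.2.1.symm)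
      (hP F h.right_mem G hG.1 hG.2.2.symm) h.mem_left h.mem_right ?_ ?_
    · exact fun hx => hG.2.1 (eq_of_mem_of_mem h.disjoint hG.1 h.left_mem hx h.mem_left)
    · exact fun hy => hG.2.2 (eq_of_mem_of_mem h.disjoint hG.1 h.right_mem hy h.mem_right)
  have hr' : ∀ {G}, G ∈ P ∧ G ≠ E ∧ G ≠ F → NoncrossingPair G (C ∪ D) := fun hG =>
    (hr hG).symm (h.disjoint_rest hG.1 hG.2.1 hG.2.2)
  intro B hB B' hB' hne
  rw [h.mem_iff] at hB hB'
  rcases hB with hB | rfl | rfl <;> rcases hB' with hB' | rfl | rfl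
  · exact hP B hB.1 B' hB'.1 hne
  · exact (hr' hB).mono_right subset_union_left
  · exact (hr' hB).mono_right subset_union_right
  · exact (hr hB').mono subset_union_left
  · exact absurd rfl hne
  · exact hCD
  · exact (hr hB').mono subset_union_right
  · exact hCD.symm h.disjoint_new
  · exact absurd rfl hne

theorem familyElement_eq (h : Redistribution P x y E F C D) {M : Type*} [AddCommGroup M]
    [Module ℂ M] (ξ η : Fin n → M) : familyElement ξ η (replaceBlocks P x y C D) =
      familyElement ξ η (P \ {E, F}) * (blockElement ξ η C * blockElement ξ η D) := by
  rw [h.replaceBlocks_eq, familyElement, prod_union, prod_pair h.new_ne, familyElement]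
  rw [disjoint_left]
  intro B hB hB'
  simp only [mem_sdiff, mem_insert, mem_singleton, not_or] at hB hB'
  have hd := h.disjoint_rest hB.1 hB.2.1 hB.2.2
  have hsub : B ⊆ C ∪ D := by
    rcases hB' with rfl | rfl
    · exact subset_union_left
    · exact subset_union_right
  have : B = ∅ := disjoint_self.1 (hd.mono_left hsub)
  exact h.empty_notMem (this ▸ hB.1)

end Redistribution

end Families

/-! ### The symmetric group action on the exterior algebra -/

section Realization

variable {n : ℕ}

/-- The exterior algebra on two odd generators for each point of `[n]`. -/
abbrev PointAlgebra (n : ℕ) : Type := ExteriorAlgebra ℂ (Fin n × Bool →₀ ℂ)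

/-- The two odd generators at a point of `[n]`, distinguished by the Boolean. -/
noncomputable def pointVec (b : Bool) (a : Fin n) : Fin n × Bool →₀ ℂ := Finsupp.single (a, b) 1

/-- The product over the members `B` of the family of the sums of `x_a ∧ y_b` over the ordered pairs
of distinct elements of `B`. -/
noncomputable def realization (P : SetFamily n) : PointAlgebra n :=
  (familyElement (pointVec false) (pointVec true) P : PointAlgebra n)

/-- The linear map of the space of generators induced by a permutation of the points. -/
noncomputable def pointMap (w : Perm (Fin n)) : (Fin n × Bool →₀ ℂ) →ₗ[ℂ] (Fin n × Bool →₀ ℂ) :=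
  Finsupp.lmapDomain ℂ ℂ (Prod.map w id)

theorem pointMap_one : pointMap (1 : Perm (Fin n)) = LinearMap.id := by
  ext p
  simp [pointMap]

theorem pointMap_mul (v w : Perm (Fin n)) : pointMap (v * w) = pointMap v ∘ₗ pointMap w := by
  ext ⟨a, b⟩
  simp [pointMap]

theorem pointMap_comp_pointVec (w : Perm (Fin n)) (b : Bool) :
    pointMap w ∘ pointVec b = pointVec b ∘ w := by
  ext1 a
  simp [pointVec, pointMap]

/-- The sign-twisted action of the symmetric group on the exterior algebra that permutes the
points. -/
noncomputable def pointRep (n : ℕ) : Representation ℂ (Perm (Fin n)) (PointAlgebra n) where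
  toFun w := ((Perm.sign w : ℤ) : ℂ) • (ExteriorAlgebra.map (pointMap w)).toLinearMap
  map_one' := by
    rw [pointMap_one]
    simp [Module.End.one_eq_id]
  map_mul' v w := by
    rw [pointMap_mul, ← ExteriorAlgebra.map_comp_map, Perm.sign_mul, Units.val_mul, Int.cast_mul]
    refine LinearMap.ext fun z => ?_
    simp only [LinearMap.smul_apply, Module.End.mul_apply, AlgHom.toLinearMap_apply,
      AlgHom.comp_apply, map_smul, smul_smul]
    rw [mul_comm ((Perm.sign v : ℤ) : ℂ)]

theorem pointRep_realization (w : Perm (Fin n)) (P : SetFamily n) :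
    pointRep n w (realization P) = ((Perm.sign w : ℤ) : ℂ) • realization (permute w P) := by
  change ((Perm.sign w : ℤ) : ℂ) • ExteriorAlgebra.map (pointMap w) (realization P) = _
  rw [realization, map_familyElement, realization, familyElement_permute, pointMap_comp_pointVec,
    pointMap_comp_pointVec]

/-- The linear extension of `realization` to the span of all families. -/
noncomputable def realizationMap (n : ℕ) : FamilySpace n →ₗ[ℂ] PointAlgebra n :=
  Finsupp.linearCombination ℂ realization

@[simp] theorem realizationMap_basisVec (P : SetFamily n) :
    realizationMap n (basisVec P) = realization P := by
  simp [realizationMap, basisVec]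

theorem realizationMap_apply (v : FamilySpace n) :
    realizationMap n v = ∑ P ∈ v.support, v P • realization P :=
  Finsupp.linearCombination_apply ℂ v

/-! ### The local rules as resolutions of crossings -/

section Resolution

variable {P : SetFamily n} {x y : Fin n} {E F : Finset (Fin n)}

/-- The data of two distinct blocks `E ∋ x` and `F ∋ y` of a family of disjoint sets, neither of
them a singleton. -/
structure TwoBlocks (P : SetFamily n) (x y : Fin n) (E F : Finset (Fin n)) : Prop where
  disjoint : (P : Set (Finset (Fin n))).PairwiseDisjoint id
  empty_notMem : ∅ ∉ P
  left_mem : E ∈ P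
  right_mem : F ∈ P
  ne : E ≠ F
  mem_left : x ∈ E
  mem_right : y ∈ F
  left_ne : E ≠ {x}
  right_ne : F ≠ {y}

namespace TwoBlocks

theorem erase_left (h : TwoBlocks P x y E F) : (E.erase x).Nonempty := by
  rw [nonempty_iff_ne_empty, ne_eq, erase_eq_empty_iff, not_or]
  exact ⟨ne_empty_of_mem h.mem_left, h.left_ne⟩

theorem erase_right (h : TwoBlocks P x y E F) : (F.erase y).Nonempty := by
  rw [nonempty_iff_ne_empty, ne_eq, erase_eq_empty_iff, not_or]
  exact ⟨ne_empty_of_mem h.mem_right, h.right_ne⟩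

theorem disjoint_blocks (h : TwoBlocks P x y E F) : Disjoint E F :=
  h.disjoint h.left_mem h.right_mem h.ne

theorem notMem_left (h : TwoBlocks P x y E F) : y ∉ E := fun hy =>
  disjoint_left.1 h.disjoint_blocks hy h.mem_right

theorem notMem_right (h : TwoBlocks P x y E F) : x ∉ F := fun hx =>
  disjoint_left.1 h.disjoint_blocks h.mem_left hx

theorem ne_points (h : TwoBlocks P x y E F) : x ≠ y := fun e => h.notMem_left (e ▸ h.mem_left)

theorem union_eq (h : TwoBlocks P x y E F) :
    {x, y} ∪ (E.erase x ∪ F.erase y) = E ∪ F := by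
  ext z
  have h1 := h.mem_left
  have h2 := h.mem_right
  simp only [mem_union, mem_insert, mem_singleton, mem_erase]
  grind

/-- The redistribution into `{x, y}` and the union of the remainders. -/
theorem merge (h : TwoBlocks P x y E F) :
    Redistribution P x y E F {x, y} (E.erase x ∪ F.erase y) where
  __ := h
  nonempty_left := ⟨x, by simp⟩
  nonempty_right := h.erase_left.mono subset_union_left
  disjoint_new := by
    have h1 := h.notMem_left
    have h2 := h.notMem_right
    simp [h1, h2]
  union_eq := h.union_eq

/-- The redistribution that moves `y` to the block of `x`. -/
theorem moveRight (h : TwoBlocks P x y E F) :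
    Redistribution P x y E F ({x, y} ∪ E.erase x) (F.erase y) where
  __ := h
  nonempty_left := ⟨x, by simp⟩
  nonempty_right := h.erase_right
  disjoint_new := by
    have h2 := h.notMem_right
    have h3 := h.disjoint_blocks.mono (erase_subset x E) (erase_subset y F)
    simpa [disjoint_union_left, h2] using h3
  union_eq := by rw [union_assoc, h.union_eq]

/-- The redistribution that moves `x` to the block of `y`. -/
theorem moveLeft (h : TwoBlocks P x y E F) :
    Redistribution P x y E F ({x, y} ∪ F.erase y) (E.erase x) where
  __ := h
  nonempty_left := ⟨x, by simp⟩
  nonempty_right := h.erase_left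
  disjoint_new := by
    have h2 := h.notMem_left
    have h3 := (h.disjoint_blocks.mono (erase_subset x E) (erase_subset y F)).symm
    simpa [disjoint_union_left, h2] using h3
  union_eq := by rw [union_assoc, union_comm (F.erase y), h.union_eq]

theorem noncrossing_merge (h : TwoBlocks P x y E F) (hxy : (y : ℕ) = x + 1) :
    NoncrossingPair {x, y} (E.erase x ∪ F.erase y) := by
  have h1 := h.notMem_left
  have h2 := h.notMem_right
  rw [insert_eq]
  exact NoncrossingPair.union hxy (noncrossingPair_singleton _ _) (noncrossingPair_singleton _ _)
    (mem_singleton_self x) (mem_singleton_self y) (by simp [h2]) (by simp [h1])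

theorem noncrossing_moveRight (h : TwoBlocks P x y E F) (hxy : (y : ℕ) = x + 1)
    (hP : Noncrossing P) : NoncrossingPair ({x, y} ∪ E.erase x) (F.erase y) := by
  have h2 := h.notMem_right
  have e : {x, y} ∪ E.erase x = E ∪ {y} := by
    have := h.mem_left
    ext z
    simp only [mem_union, mem_insert, mem_singleton, mem_erase]
    grind
  rw [noncrossing_iff h.disjoint] at hP
  rw [e]
  exact NoncrossingPair.union hxy
    ((hP E h.left_mem F h.right_mem h.ne).mono_right (erase_subset _ _))
    (noncrossingPair_singleton _ _) h.mem_left (mem_singleton_self y) (by simp [h2]) (by simp)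

theorem noncrossing_moveLeft (h : TwoBlocks P x y E F) (hxy : (y : ℕ) = x + 1)
    (hP : Noncrossing P) : NoncrossingPair ({x, y} ∪ F.erase y) (E.erase x) := by
  have h2 := h.notMem_left
  have e : {x, y} ∪ F.erase y = {x} ∪ F := by
    have := h.mem_right
    ext z
    simp only [mem_union, mem_insert, mem_singleton, mem_erase]
    grind
  rw [noncrossing_iff h.disjoint] at hP
  rw [e]
  exact NoncrossingPair.union hxy (noncrossingPair_singleton _ _)
    ((hP F h.right_mem E h.left_mem h.ne.symm).mono_right (erase_subset _ _))
    (mem_singleton_self x) h.mem_right (by simp) (by simp [h2])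

theorem prod_eq (h : TwoBlocks P x y E F) {R : Type*} [CommMonoid R] (g : Finset (Fin n) → R) :
    ∏ B ∈ P, g B = (∏ B ∈ P \ {E, F}, g B) * (g E * g F) := by
  rw [← prod_pair h.ne, prod_sdiff]
  simp [insert_subset_iff, h.left_mem, h.right_mem]

theorem image_swap_left (h : TwoBlocks P x y E F) :
    E.image (swap x y) = insert y (E.erase x) := by
  nth_rw 1 [← insert_erase h.mem_left]
  rw [image_insert, swap_apply_left]
  congr 1
  refine (image_congr fun z hz => ?_).trans image_id
  rw [mem_coe, mem_erase] at hz
  exact swap_apply_of_ne_of_ne hz.1 fun e => h.notMem_left (e ▸ hz.2)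

theorem image_swap_right (h : TwoBlocks P x y E F) :
    F.image (swap x y) = insert x (F.erase y) := by
  nth_rw 1 [← insert_erase h.mem_right]
  rw [image_insert, swap_apply_right]
  congr 1
  refine (image_congr fun z hz => ?_).trans image_id
  rw [mem_coe, mem_erase] at hz
  exact swap_apply_of_ne_of_ne (fun e => h.notMem_right (e ▸ hz.2)) hz.1

theorem image_swap_rest (h : TwoBlocks P x y E F) {B : Finset (Fin n)} (hB : B ∈ P \ {E, F}) :
    B.image (swap x y) = B := by
  simp only [mem_sdiff, mem_insert, mem_singleton, not_or] at hB
  refine (image_congr fun z hz => ?_).trans image_id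
  refine swap_apply_of_ne_of_ne ?_ ?_
  · rintro rfl
    exact hB.2.1 (eq_of_mem_of_mem h.disjoint hB.1 h.left_mem hz h.mem_left)
  · rintro rfl
    exact hB.2.2 (eq_of_mem_of_mem h.disjoint hB.1 h.right_mem hz h.mem_right)

/-- Exchanging `x` and `y` in two blocks is resolved by the four-term rule. -/
theorem pointRep_swap (h : TwoBlocks P x y E F) :
    pointRep n (swap x y) (realization P) = realization P +
      realization (replaceBlocks P x y {x, y} (E.erase x ∪ F.erase y)) -
      realization (replaceBlocks P x y ({x, y} ∪ E.erase x) (F.erase y)) -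
      realization (replaceBlocks P x y ({x, y} ∪ F.erase y) (E.erase x)) := by
  rw [pointRep_realization, Perm.sign_swap h.ne_points]
  simp only [realization, h.merge.familyElement_eq, h.moveRight.familyElement_eq,
    h.moveLeft.familyElement_eq]
  have hs : familyElement (pointVec false) (pointVec true) (permute (swap x y) P) =
      familyElement (pointVec false) (pointVec true) (P \ {E, F}) *
        (blockElement (pointVec false) (pointVec true) (insert y (E.erase x)) *
          blockElement (pointVec false) (pointVec true) (insert x (F.erase y))) := by
    rw [familyElement, permute,
      prod_image fun A _ B _ e => image_injective (swap x y).injective e, h.prod_eq,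
      h.image_swap_left, h.image_swap_right]
    congr 1
    exact prod_congr rfl fun B hB => by rw [h.image_swap_rest hB]
  have hP : familyElement (pointVec false) (pointVec true) P =
      familyElement (pointVec false) (pointVec true) (P \ {E, F}) *
        (blockElement (pointVec false) (pointVec true) (insert x (E.erase x)) *
          blockElement (pointVec false) (pointVec true) (insert y (F.erase y))) := by
    rw [insert_erase h.mem_left, insert_erase h.mem_right]
    exact h.prod_eq _
  have key := blockElement_resolution (pointVec (n := n) false) (pointVec true) h.ne_points
    (h.disjoint_blocks.mono (erase_subset x E) (erase_subset y F)) (notMem_erase x E)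
    (fun hy => h.notMem_left (mem_of_mem_erase hy)) (fun hx => h.notMem_right (mem_of_mem_erase hx))
    (notMem_erase y F)
  rw [hs, hP, Units.val_neg, Units.val_one, Int.cast_neg, Int.cast_one, neg_one_smul]
  exact congrArg (Subalgebra.center ℂ (PointAlgebra n)).val (mul_four_term
    (familyElement (pointVec false) (pointVec true) (P \ {E, F})) key)

end TwoBlocks

theorem Redistribution.basisVec_mem {C D : Finset (Fin n)}
    (hR : Redistribution P x y E F C D) (hxy : (y : ℕ) = x + 1)
    (hP : IsSetPartition P ∧ Noncrossing P ∧ SingletonFree P) (hCD : NoncrossingPair C D)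
    (hC : C.card ≠ 1) (hD : D.card ≠ 1) :
    basisVec (replaceBlocks P x y C D) ∈ NCPZeroSpace n := by
  refine Finsupp.single_mem_supported ℂ 1 ⟨hR.isSetPartition hP.1, hR.noncrossing hxy hP.2.1 hCD,
    fun B hB => ?_⟩
  rcases hR.mem_iff.1 hB with hB | rfl | rfl
  · exact hP.2.2 B hB.1
  · exact hC
  · exact hD

/-- The omitted terms of the skein rule are realized by zero. -/
theorem realization_eq_zero_of_card {C D : Finset (Fin n)} (h : Redistribution P x y E F C D)
    (hD : ¬2 ≤ D.card) : realization (replaceBlocks P x y C D) = 0 := by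
  have hD1 : D.card = 1 := by
    have := h.nonempty_right.card_pos
    omega
  obtain ⟨a, rfl⟩ := card_eq_one.1 hD1
  rw [realization, h.familyElement_eq, blockElement_singleton, mul_zero, mul_zero]
  rfl

theorem permute_swap_eq (hd : (P : Set (Finset (Fin n))).PairwiseDisjoint id) (hE : E ∈ P)
    (hx : x ∈ E) (hy : y ∈ E) : permute (swap x y) P = P := by
  refine (image_congr fun B hB => ?_).trans image_id
  rw [mem_coe] at hB
  have hxB : x ∈ B ↔ y ∈ B :=
    ⟨fun h => eq_of_mem_of_mem hd hB hE h hx ▸ hy, fun h => eq_of_mem_of_mem hd hB hE h hy ▸ hx⟩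
  have hmem : ∀ z, swap x y z ∈ B ↔ z ∈ B := by
    intro z
    rw [swap_apply_def]
    split_ifs with h1 h2
    · rw [h1, hxB]
    · rw [h2, hxB]
    · rfl
  ext z
  rw [mem_image, id]
  constructor
  · rintro ⟨u, hu, rfl⟩
    exact (hmem u).2 hu
  · intro hz
    exact ⟨swap x y z, (hmem z).2 hz, swap_apply_self x y z⟩

theorem IsMatching.empty_notMem (hm : IsMatching P) : ∅ ∉ P := fun h => by
  simpa using hm.1 ∅ h

theorem IsMatching.twoBlocks (hm : IsMatching P) (hE : E ∈ P) (hF : F ∈ P) (hEF : E ≠ F)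
    (hx : x ∈ E) (hy : y ∈ F) : TwoBlocks P x y E F where
  disjoint := hm.2
  empty_notMem := hm.empty_notMem
  left_mem := hE
  right_mem := hF
  ne := hEF
  mem_left := hx
  mem_right := hy
  left_ne h := by simpa [h] using hm.1 E hE
  right_ne h := by simpa [h] using hm.1 F hF

theorem IsMatching.permute (hm : IsMatching P) (w : Perm (Fin n)) : IsMatching (permute w P) := by
  constructor
  · intro e he
    obtain ⟨B, hB, rfl⟩ := mem_image.1 he
    rw [card_image_of_injective _ w.injective, hm.1 B hB]
  · intro e he f hf hne
    obtain ⟨B, hB, rfl⟩ := mem_image.1 he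
    obtain ⟨C, hC, rfl⟩ := mem_image.1 hf
    exact (disjoint_image w.injective).2 (hm.2 hB hC fun h => hne (by rw [h]))

theorem ptolemyStep_realization (hxy : (y : ℕ) = x + 1) (hm : IsMatching P)
    (hnc : Noncrossing P) :
    realizationMap n (ptolemyStep x y P) = pointRep n (swap x y) (realization P) := by
  unfold ptolemyStep
  split_ifs with hs
  · rw [signedPermute, map_smul, realizationMap_basisVec, pointRep_realization]
  · obtain ⟨E, hE, F, hF, hEF, hx, hy⟩ := exists_blocks_of_permute_crossing hxy hnc hs
    have h := hm.twoBlocks hE hF hEF hx hy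
    rw [h.pointRep_swap, realization_eq_zero_of_card h.moveRight,
      realization_eq_zero_of_card h.moveLeft, blockOf_eq hm.2 hE hx, blockOf_eq hm.2 hF hy]
    · simp
    · rw [card_erase_of_mem hx, hm.1 E hE]
      simp
    · rw [card_erase_of_mem hy, hm.1 F hF]
      simp

theorem ptolemyStep_mem (hxy : (y : ℕ) = x + 1) (hm : IsMatching P) (hnc : Noncrossing P) :
    ptolemyStep x y P ∈ NCMSpace n := by
  unfold ptolemyStep
  split_ifs with hs
  · exact Submodule.smul_mem _ _ (Finsupp.single_mem_supported ℂ 1 ⟨hm.permute _, hs⟩)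
  · obtain ⟨E, hE, F, hF, hEF, hx, hy⟩ := exists_blocks_of_permute_crossing hxy hnc hs
    have h := hm.twoBlocks hE hF hEF hx hy
    rw [blockOf_eq hm.2 hE hx, blockOf_eq hm.2 hF hy]
    refine Submodule.add_mem _ (Finsupp.single_mem_supported ℂ 1 ⟨hm, hnc⟩)
      (Finsupp.single_mem_supported ℂ 1 ⟨⟨fun B hB => ?_, h.merge.pairwiseDisjoint⟩,
        h.merge.noncrossing hxy hnc (h.noncrossing_merge hxy)⟩)
    rcases h.merge.mem_iff.1 hB with hB | rfl | rfl
    · exact hm.1 B hB.1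
    · exact card_pair h.ne_points
    · rw [card_union_of_disjoint (h.disjoint_blocks.mono (erase_subset x E) (erase_subset y F)),
        card_erase_of_mem hx, card_erase_of_mem hy, hm.1 E hE, hm.1 F hF]

theorem SingletonFree.twoBlocks (hs : SingletonFree P) (hP : IsSetPartition P) (hE : E ∈ P)
    (hF : F ∈ P) (hEF : E ≠ F) (hx : x ∈ E) (hy : y ∈ F) : TwoBlocks P x y E F where
  disjoint := (isSetPartition_iff.1 hP).2.1
  empty_notMem := (isSetPartition_iff.1 hP).1
  left_mem := hE
  right_mem := hF
  ne := hEF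
  mem_left := hx
  mem_right := hy
  left_ne h := hs E hE (by simp [h])
  right_ne h := hs F hF (by simp [h])

theorem skeinStep_of_eq (hd : (P : Set (Finset (Fin n))).PairwiseDisjoint id) (hE : E ∈ P)
    (hx : x ∈ E) (hy : y ∈ E) : skeinStep x y P = -basisVec P := by
  simp only [skeinStep]
  rw [blockOf_eq hd hE hx, blockOf_eq hd hE hy, if_pos rfl]

theorem TwoBlocks.skeinStep_eq (h : TwoBlocks P x y E F) : skeinStep x y P =
    basisVec P + basisVec (replaceBlocks P x y {x, y} (E.erase x ∪ F.erase y))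
      - (if 2 ≤ (F.erase y).card then
          basisVec (replaceBlocks P x y ({x, y} ∪ E.erase x) (F.erase y)) else 0)
      - (if 2 ≤ (E.erase x).card then
          basisVec (replaceBlocks P x y ({x, y} ∪ F.erase y) (E.erase x)) else 0) := by
  simp only [skeinStep]
  rw [blockOf_eq h.disjoint h.left_mem h.mem_left, blockOf_eq h.disjoint h.right_mem h.mem_right,
    if_neg h.ne, if_neg (not_or.2 ⟨h.left_ne, h.right_ne⟩)]

theorem skeinStep_realization (hxy : (y : ℕ) = x + 1) (hP : IsSetPartition P)
    (hs : SingletonFree P) :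
    realizationMap n (skeinStep x y P) = pointRep n (swap x y) (realization P) := by
  obtain ⟨E, hE, hx⟩ := (isSetPartition_iff.1 hP).2.2 x
  obtain ⟨F, hF, hy⟩ := (isSetPartition_iff.1 hP).2.2 y
  by_cases hEF : E = F
  · subst hEF
    have hne : x ≠ y := fun e => by rw [e] at hxy; omega
    have hd := (isSetPartition_iff.1 hP).2.1
    rw [skeinStep_of_eq hd hE hx hy, pointRep_realization, permute_swap_eq hd hE hx hy,
      Perm.sign_swap hne]
    simp
  · have h := hs.twoBlocks hP hE hF hEF hx hy
    rw [h.skeinStep_eq, h.pointRep_swap]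
    simp only [map_sub, map_add, realizationMap_basisVec]
    congr 1
    · congr 1
      split_ifs with hc
      · exact realizationMap_basisVec _
      · rw [map_zero, realization_eq_zero_of_card h.moveRight hc]
    · split_ifs with hc
      · exact realizationMap_basisVec _
      · rw [map_zero, realization_eq_zero_of_card h.moveLeft hc]

theorem skeinStep_mem (hxy : (y : ℕ) = x + 1)
    (hP : IsSetPartition P ∧ Noncrossing P ∧ SingletonFree P) :
    skeinStep x y P ∈ NCPZeroSpace n := by
  obtain ⟨E, hE, hx⟩ := (isSetPartition_iff.1 hP.1).2.2 x
  obtain ⟨F, hF, hy⟩ := (isSetPartition_iff.1 hP.1).2.2 y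
  have hP0 : basisVec P ∈ NCPZeroSpace n := Finsupp.single_mem_supported ℂ 1 hP
  by_cases hEF : E = F
  · subst hEF
    rw [skeinStep_of_eq (isSetPartition_iff.1 hP.1).2.1 hE hx hy]
    exact Submodule.neg_mem _ hP0
  · have h := hP.2.2.twoBlocks hP.1 hE hF hEF hx hy
    have hcard : ∀ C : Finset (Fin n), ({x, y} ∪ C).card ≠ 1 := fun C hC => by
      have := card_le_card (subset_union_left (s₁ := {x, y}) (s₂ := C))
      rw [card_pair h.ne_points] at this
      omega
    rw [h.skeinStep_eq]
    refine Submodule.sub_mem _ (Submodule.sub_mem _ (Submodule.add_mem _ hP0 ?_) ?_) ?_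
    · refine h.merge.basisVec_mem hxy hP (h.noncrossing_merge hxy) ?_ ?_
      · rw [card_pair h.ne_points]
        omega
      · rw [card_union_of_disjoint (h.disjoint_blocks.mono (erase_subset x E) (erase_subset y F))]
        have := h.erase_left.card_pos
        have := h.erase_right.card_pos
        omega
    · split_ifs with hc
      · exact h.moveRight.basisVec_mem hxy hP (h.noncrossing_moveRight hxy hP.2.1) (hcard _)
          (by omega)
      · exact Submodule.zero_mem _
    · split_ifs with hc
      · exact h.moveLeft.basisVec_mem hxy hP (h.noncrossing_moveLeft hxy hP.2.1) (hcard _)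
          (by omega)
      · exact Submodule.zero_mem _

end Resolution

end Realization

/-! ### Independence of the realizations of noncrossing matchings -/

/-- A family of vectors is independent if it is triangular with respect to some family of linear
maps, one for each index, and some ranking of the indices. -/
theorem eq_zero_of_triangular {ι V W β : Type*} [AddCommGroup V] [Module ℂ V] [AddCommGroup W]
    [Module ℂ W] [LinearOrder β] (φ : ι → V) (S : Set ι) (c : ι → V →ₗ[ℂ] W) (r : ι → β)
    (hdiag : ∀ i ∈ S, c i (φ i) ≠ 0)
    (htri : ∀ i ∈ S, ∀ j ∈ S, c i (φ j) ≠ 0 → j = i ∨ r j < r i)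
    (v : ι →₀ ℂ) (hv : v ∈ Finsupp.supported ℂ ℂ S)
    (h : Finsupp.linearCombination ℂ φ v = 0) : v = 0 := by
  by_contra hne
  obtain ⟨i, hi, hmin⟩ := v.support.exists_min_image r (Finsupp.support_nonempty_iff.2 hne)
  have hS : ∀ j ∈ v.support, j ∈ S := fun j hj => (Finsupp.mem_supported ℂ v).1 hv hj
  have h1 := congrArg (c i) h
  rw [Finsupp.linearCombination_apply, Finsupp.sum, map_sum, map_zero, sum_eq_single i] at h1
  · rw [map_smul, smul_eq_zero] at h1
    exact h1.elim (Finsupp.mem_support_iff.1 hi) (hdiag i (hS i hi))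
  · intro j hj hji
    rw [map_smul]
    by_cases hz : c i (φ j) = 0
    · rw [hz, smul_zero]
    · rcases htri i (hS i hi) j (hS j hj) hz with e | e
      · exact absurd e hji
      · exact absurd (hmin j hj) (not_le.2 e)
  · exact fun h => absurd hi h

section Matchings

variable {n : ℕ}

/-- The smaller elements of the pairs of a matching. -/
def openers (m : SetFamily n) : Finset (Fin n) := univ.filter fun a => ∃ b, a < b ∧ {a, b} ∈ m

/-- The larger elements of the pairs of a matching. -/
def closers (m : SetFamily n) : Finset (Fin n) := univ.filter fun b => ∃ a, a < b ∧ {a, b} ∈ m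

theorem mem_openers {m : SetFamily n} {a : Fin n} :
    a ∈ openers m ↔ ∃ b, a < b ∧ {a, b} ∈ m := by
  simp [openers]

theorem mem_closers {m : SetFamily n} {b : Fin n} :
    b ∈ closers m ↔ ∃ a, a < b ∧ {a, b} ∈ m := by
  simp [closers]

theorem exists_lt_of_card_eq_two {e : Finset (Fin n)} (he : e.card = 2) :
    ∃ a b, a < b ∧ e = {a, b} := by
  obtain ⟨a, b, hab, rfl⟩ := card_eq_two.1 he
  rcases lt_or_gt_of_ne hab with h | h
  · exact ⟨a, b, h, rfl⟩
  · exact ⟨b, a, h, pair_comm a b⟩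

namespace IsMatching

variable {m : SetFamily n} {a b c d : Fin n}

theorem right_unique (hm : IsMatching m) (hab : a < b) (h : {a, b} ∈ m)
    (h' : {a, d} ∈ m) : b = d := by
  have e := eq_of_mem_of_mem hm.2 h h' (z := a) (by simp) (by simp)
  have : b ∈ ({a, d} : Finset (Fin n)) := e ▸ by simp
  simpa [hab.ne'] using this

theorem left_unique (hm : IsMatching m) (hab : a < b) (h : {a, b} ∈ m)
    (h' : {c, b} ∈ m) : a = c := by
  have e := eq_of_mem_of_mem hm.2 h h' (z := b) (by simp) (by simp)
  have : a ∈ ({c, b} : Finset (Fin n)) := e ▸ by simp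
  simpa [hab.ne] using this

theorem notMem_closers (hm : IsMatching m) (h : a ∈ openers m) : a ∉ closers m := by
  intro h'
  obtain ⟨b, hab, hb⟩ := mem_openers.1 h
  obtain ⟨c, hca, hc⟩ := mem_closers.1 h'
  have e := eq_of_mem_of_mem hm.2 hb hc (z := a) (by simp) (by simp)
  have : b ∈ ({c, a} : Finset (Fin n)) := e ▸ by simp
  simp only [mem_insert, mem_singleton] at this
  grind

theorem card_openers (hm : IsMatching m) : (openers m).card = (closers m).card := by
  apply le_antisymm
  · refine card_le_card_of_forall_subsingleton (fun a b => a < b ∧ {a, b} ∈ m) ?_ ?_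
    · intro a ha
      obtain ⟨b, hb⟩ := mem_openers.1 ha
      exact ⟨b, mem_closers.2 ⟨a, hb⟩, hb⟩
    · rintro b - a ⟨-, ha⟩ c ⟨-, hc⟩
      exact hm.left_unique ha.1 ha.2 hc.2
  · refine card_le_card_of_forall_subsingleton (fun b a => a < b ∧ {a, b} ∈ m) ?_ ?_
    · intro b hb
      obtain ⟨a, ha⟩ := mem_closers.1 hb
      exact ⟨a, mem_openers.2 ⟨b, ha⟩, ha⟩
    · rintro a - b ⟨-, hb⟩ d ⟨-, hd⟩
      exact hm.right_unique hb.1 hb.2 hd.2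

/-- Two noncrossing matchings with the same openers and closers share a pair as soon as they share
all shorter pairs: otherwise the partners of its end points would give a shorter pair or a
crossing. -/
theorem pair_mem_of_shorter {m' : SetFamily n} (hm : IsMatching m)
    (hnc : Noncrossing m') (hO : openers m = openers m') (hC : closers m = closers m')
    (hab : a < b) (ih : ∀ c d : Fin n, c < d → (d : ℕ) - c < b - a → {c, d} ∈ m' → {c, d} ∈ m)
    (h : {a, b} ∈ m) : {a, b} ∈ m' := by
  obtain ⟨b', hab', hb'⟩ := mem_openers.1 (hO ▸ mem_openers.2 ⟨b, hab, h⟩)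
  obtain ⟨a', hab'', ha'⟩ := mem_closers.1 (hC ▸ mem_closers.2 ⟨a, hab, h⟩)
  rcases lt_trichotomy b' b with hlt | rfl | hlt
  · have := hm.right_unique hab h (ih a b' hab' (by simp only [Fin.lt_def] at *; omega) hb')
    exact absurd this hlt.ne'
  · exact hb'
  · rcases lt_trichotomy a' a with hlt' | rfl | hlt'
    · refine absurd ⟨a', by simp, a, by simp, b, by simp, b', by simp, hlt', hab, hlt⟩
        (hnc _ ha' _ hb' fun e => ?_)
      have : a' ∈ ({a, b'} : Finset (Fin n)) := e ▸ by simp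
      simp only [mem_insert, mem_singleton] at this
      grind
    · exact ha'
    · have := hm.left_unique hab h (ih a' b hab'' (by simp only [Fin.lt_def] at *; omega) ha')
      exact absurd this hlt'.ne

/-- A noncrossing matching is determined by its openers and closers. -/
theorem eq_of_openers_closers {m' : SetFamily n} (hm : IsMatching m) (hm' : IsMatching m')
    (hnc : Noncrossing m) (hnc' : Noncrossing m') (hO : openers m = openers m')
    (hC : closers m = closers m') : m = m' := by
  have key : ∀ k : ℕ, ∀ a b : Fin n, a < b → (b : ℕ) - a = k → ({a, b} ∈ m ↔ {a, b} ∈ m') := by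
    intro k
    induction k using Nat.strong_induction_on with
    | _ k ih =>
      intro a b hab hk
      exact ⟨hm.pair_mem_of_shorter hnc' hO hC hab
          fun c d hcd hlt => (ih _ (hk ▸ hlt) c d hcd rfl).2,
        hm'.pair_mem_of_shorter hnc hO.symm hC.symm hab
          fun c d hcd hlt => (ih _ (hk ▸ hlt) c d hcd rfl).1⟩
  ext e
  constructor
  · intro he
    obtain ⟨a, b, hab, rfl⟩ := exists_lt_of_card_eq_two (hm.1 e he)
    exact (key _ a b hab rfl).1 he
  · intro he
    obtain ⟨a, b, hab, rfl⟩ := exists_lt_of_card_eq_two (hm'.1 e he)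
    exact (key _ a b hab rfl).2 he

/-- If every pair of `m'` joins an opener of `m` to a closer of `m`, then passing from the openers
of `m'` to the openers of `m` in the same pairs moves them to the right. -/
theorem eq_or_sum_openers_lt {m' : SetFamily n} (hm : IsMatching m) (hm' : IsMatching m')
    (hnc : Noncrossing m) (hnc' : Noncrossing m')
    (h : ∀ a b, {a, b} ∈ m' →
      (a ∈ openers m ∧ b ∈ closers m) ∨ (b ∈ openers m ∧ a ∈ closers m)) :
    m' = m ∨ ∑ a ∈ openers m', ((a : ℕ) + 1) < ∑ a ∈ openers m, ((a : ℕ) + 1) := by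
  by_cases hlt : ∑ a ∈ openers m', ((a : ℕ) + 1) < ∑ a ∈ openers m, ((a : ℕ) + 1)
  · exact Or.inr hlt
  left
  have hex : ∀ a : Fin n, ∃ z, a ∈ openers m' →
      z ∈ openers m ∧ a ≤ z ∧ ∃ b, a < b ∧ {a, b} ∈ m' ∧ (z = a ∨ z = b) := by
    intro a
    by_cases ha : a ∈ openers m'
    · obtain ⟨b, hab, hb⟩ := mem_openers.1 ha
      rcases h a b hb with h1 | h1
      · exact ⟨a, fun _ => ⟨h1.1, le_rfl, b, hab, hb, Or.inl rfl⟩⟩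
      · exact ⟨b, fun _ => ⟨h1.1, hab.le, b, hab, hb, Or.inr rfl⟩⟩
    · exact ⟨a, fun h => absurd h ha⟩
  -- `g a` is the opener of `m` in the pair of `m'` that `a` opens.
  choose g hg using hex
  have hinj : Set.InjOn g (openers m') := by
    intro a ha c hc hac
    rw [mem_coe] at ha hc
    obtain ⟨-, -, b, hab, hb, hgb⟩ := hg a ha
    obtain ⟨-, -, d, hcd, hd, hgd⟩ := hg c hc
    have e := eq_of_mem_of_mem hm'.2 hb hd (z := g a)
      (by simpa using hgb) (by rw [hac]; simpa using hgd)
    have : c ∈ ({a, b} : Finset (Fin n)) := e ▸ by simp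
    rcases mem_insert.1 this with rfl | h1
    · rfl
    · rw [mem_singleton] at h1
      subst h1
      exact absurd (mem_closers.2 ⟨a, hab, hb⟩) (hm'.notMem_closers hc)
  have hsub : (openers m').image g ⊆ openers m := by
    intro z hz
    obtain ⟨a, ha, rfl⟩ := mem_image.1 hz
    exact (hg a ha).1
  have h1 : ∀ a ∈ openers m', (a : ℕ) + 1 ≤ (g a : ℕ) + 1 := fun a ha =>
    Nat.succ_le_succ (hg a ha).2.1
  have h2 : ∑ z ∈ (openers m').image g, ((z : ℕ) + 1) ≤ ∑ a ∈ openers m, ((a : ℕ) + 1) :=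
    sum_le_sum_of_subset hsub
  have h3 : ∑ z ∈ (openers m').image g, ((z : ℕ) + 1) = ∑ a ∈ openers m', ((g a : ℕ) + 1) :=
    sum_image hinj
  have h4 := sum_le_sum h1
  have h5 : ∀ a ∈ openers m', g a = a := by
    intro a ha
    have := (sum_eq_sum_iff_of_le h1).1 (by omega) a ha
    exact Fin.ext (by omega)
  have h6 : (openers m').image g = openers m' := (image_congr fun a ha => h5 a ha).trans image_id
  have hO : openers m' = openers m := by
    rw [h6] at hsub h2
    refine subset_antisymm hsub fun z hz => ?_
    by_contra hz'
    -- The summand `a + 1` is positive also at the first point, so a missing opener lowers the sum.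
    have : ∑ a ∈ openers m', ((a : ℕ) + 1) < ∑ a ∈ openers m, ((a : ℕ) + 1) :=
      sum_lt_sum_of_subset hsub hz hz' (Nat.succ_pos _) fun _ _ _ => Nat.zero_le _
    exact hlt this
  have hC : closers m' = closers m := by
    refine eq_of_subset_of_card_le (fun b hb => ?_) ?_
    · obtain ⟨a, hab, hab'⟩ := mem_closers.1 hb
      have ha : a ∈ openers m := hO ▸ mem_openers.2 ⟨b, hab, hab'⟩
      rcases h a b hab' with h7 | h7
      · exact h7.2
      · exact absurd h7.2 (hm.notMem_closers ha)
    · rw [← hm.card_openers, ← hm'.card_openers, hO]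
  exact hm'.eq_of_openers_closers hm hnc' hnc hO hC

end IsMatching

/-- The generators of one kind at the points of `K`, and zero at the other points. -/
noncomputable def cutVec (b : Bool) (K : Finset (Fin n)) (a : Fin n) : Fin n × Bool →₀ ℂ :=
  if a ∈ K then pointVec b a else 0

/-- The linear map that keeps the generators `x_a` with `a ∈ O` and `y_a` with `a ∈ C`, and
annihilates the others. -/
noncomputable def cutMap (O C : Finset (Fin n)) : (Fin n × Bool →₀ ℂ) →ₗ[ℂ] (Fin n × Bool →₀ ℂ) :=
  Finsupp.linearCombination ℂ fun p => cutVec p.2 (if p.2 then C else O) p.1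

theorem map_cutMap_realization (O C : Finset (Fin n)) (P : SetFamily n) :
    ExteriorAlgebra.map (cutMap O C) (realization P) =
      (familyElement (cutVec false O) (cutVec true C) P : PointAlgebra n) := by
  have h1 : cutMap O C ∘ pointVec false = cutVec false O := by
    ext1 a
    simp [cutMap, pointVec]
  have h2 : cutMap O C ∘ pointVec true = cutVec true C := by
    ext1 a
    simp [cutMap, pointVec]
  rw [realization, map_familyElement, h1, h2]

theorem blockElement_pair {M : Type*} [AddCommGroup M] [Module ℂ M] (x y : Fin n → M) {a b : Fin n}
    (hab : a ≠ b) : blockElement x y {a, b} = bivector (x a) (y b) + bivector (x b) (y a) := by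
  rw [blockElement_insert x y (by simpa using hab), blockElement_singleton, zero_add, sum_singleton]

theorem bivector_zero_left {M : Type*} [AddCommGroup M] [Module ℂ M] (v : M) :
    bivector 0 v = 0 := by
  ext
  simp [bivector]

theorem bivector_zero_right {M : Type*} [AddCommGroup M] [Module ℂ M] (v : M) :
    bivector v 0 = 0 := by
  ext
  simp [bivector]

theorem joins_of_familyElement_cut_ne_zero {O C : Finset (Fin n)} {m : SetFamily n}
    (hm : IsMatching m) (h : familyElement (cutVec false O) (cutVec true C) m ≠ 0) {a b : Fin n}
    (hab : {a, b} ∈ m) : (a ∈ O ∧ b ∈ C) ∨ (b ∈ O ∧ a ∈ C) := by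
  by_contra hno
  push Not at hno
  have hne : a ≠ b := by
    rintro rfl
    simpa using hm.1 _ hab
  apply h
  rw [familyElement]
  refine prod_eq_zero hab ?_
  have key : ∀ a b, (a ∈ O → b ∉ C) → bivector (cutVec false O a) (cutVec true C b) = 0 := by
    intro a b hO
    by_cases ha : a ∈ O
    · have : cutVec true C b = 0 := if_neg (hO ha)
      rw [this, bivector_zero_right]
    · have : cutVec false O a = 0 := if_neg ha
      rw [this, bivector_zero_left]
  rw [blockElement_pair _ _ hne, key a b hno.1, key b a hno.2, add_zero]

section Contraction

open CliffordAlgebra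

variable {M : Type*} [AddCommGroup M] [Module ℂ M]

theorem contractLeft_bivector_mul (d : Module.Dual ℂ M) {u v : M} (hu : d u = 0) (hv : d v = 0)
    (z : ExteriorAlgebra ℂ M) :
    contractLeft d ((bivector u v : ExteriorAlgebra ℂ M) * z) =
      (bivector u v : ExteriorAlgebra ℂ M) * contractLeft d z := by
  change contractLeft d (CliffordAlgebra.ι 0 u * CliffordAlgebra.ι 0 v * z) =
    CliffordAlgebra.ι 0 u * CliffordAlgebra.ι 0 v * contractLeft d z
  rw [mul_assoc, contractLeft_ι_mul, contractLeft_ι_mul, hu, hv]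
  simp [mul_assoc]

/-- A family element is annihilated by the contraction with a functional that vanishes on all the
vectors occurring in it. -/
theorem contractLeft_familyElement (d : Module.Dual ℂ M) (x y : Fin n → M) (P : SetFamily n)
    (h : ∀ B ∈ P, ∀ a ∈ B, d (x a) = 0 ∧ d (y a) = 0) :
    contractLeft d (familyElement x y P : ExteriorAlgebra ℂ M) = 0 := by
  unfold familyElement
  induction P using Finset.induction_on with
  | empty => exact contractLeft_one _ d
  | insert B P hB ih =>
    have hmul : ∀ z : ExteriorAlgebra ℂ M,
        contractLeft d ((blockElement x y B : ExteriorAlgebra ℂ M) * z) =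
          (blockElement x y B : ExteriorAlgebra ℂ M) * contractLeft d z := by
      intro z
      rw [blockElement, AddSubmonoidClass.coe_finsetSum, sum_mul, sum_mul, map_sum]
      refine sum_congr rfl fun p hp => ?_
      rw [mem_offDiag] at hp
      exact contractLeft_bivector_mul d (h B (mem_insert_self B P) _ hp.1).1
        (h B (mem_insert_self B P) _ hp.2.1).2 z
    rw [prod_insert hB, MulMemClass.coe_mul, hmul,
      ih fun B' hB' => h B' (mem_insert_of_mem hB'), mul_zero]

/-- A product with `u ∧ v` does not vanish if some functionals dual to `u` and `v` annihilate the
other factor. -/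
theorem bivector_mul_ne_zero {d d' : Module.Dual ℂ M} {u v : M} (hu : d u = 1) (hv : d v = 0)
    (hv' : d' v = 1) {z : ExteriorAlgebra ℂ M} (hz : contractLeft d z = 0)
    (hz' : contractLeft d' z = 0) (hne : z ≠ 0) : (bivector u v : ExteriorAlgebra ℂ M) * z ≠ 0 := by
  intro h
  have h0 : CliffordAlgebra.ι 0 u * (CliffordAlgebra.ι 0 v * z) = 0 := by
    rw [← mul_assoc]
    exact h
  have h1 := congrArg (contractLeft d) h0
  rw [contractLeft_ι_mul, contractLeft_ι_mul, hu, hv, hz, one_smul, zero_smul, mul_zero, sub_zero,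
    mul_zero, sub_zero, map_zero] at h1
  have h2 := congrArg (contractLeft d') h1
  rw [contractLeft_ι_mul, hv', hz', one_smul, mul_zero, sub_zero, map_zero] at h2
  exact hne h2

end Contraction

theorem familyElement_cut_ne_zero {O C : Finset (Fin n)} {m : SetFamily n} (hm : IsMatching m)
    (h : ∀ e ∈ m, ∃ a b, a ≠ b ∧ e = {a, b} ∧ a ∈ O ∧ b ∈ C ∧ a ∉ C) :
    (familyElement (cutVec false O) (cutVec true C) m : PointAlgebra n) ≠ 0 := by
  induction m using Finset.induction_on with
  | empty =>
    rw [familyElement, prod_empty]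
    exact one_ne_zero
  | insert e m he ih =>
    have hm' : IsMatching m := ⟨fun f hf => hm.1 f (mem_insert_of_mem hf),
      hm.2.subset (by simp)⟩
    obtain ⟨a, b, hab, rfl, ha, hb, ha'⟩ := h e (mem_insert_self e m)
    have hz := ih hm' fun f hf => h f (mem_insert_of_mem hf)
    have hout : ∀ c ∈ ({a, b} : Finset (Fin n)), ∀ f ∈ m, c ∉ f := by
      intro c hc f hf hcf
      exact he (eq_of_mem_of_mem hm.2 (mem_insert_self _ m) (mem_insert_of_mem hf) hc hcf ▸ hf)
    have hcon : ∀ c ∈ ({a, b} : Finset (Fin n)), ∀ β : Bool,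
        CliffordAlgebra.contractLeft (Finsupp.lapply (c, β) : Module.Dual ℂ (Fin n × Bool →₀ ℂ))
          (familyElement (cutVec false O) (cutVec true C) m : PointAlgebra n) = 0 := by
      intro c hc β
      refine contractLeft_familyElement _ _ _ _ fun f hf z hz => ?_
      have : z ≠ c := fun e => hout c hc f hf (e ▸ hz)
      constructor <;> unfold cutVec pointVec <;> split_ifs <;> simp [this]
    have hblock : blockElement (cutVec false O) (cutVec true C) {a, b} =
        bivector (pointVec false a) (pointVec true b) := by
      rw [blockElement_pair _ _ hab]
      simp [cutVec, ha, hb, ha', bivector_zero_right]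
    rw [familyElement, prod_insert he, MulMemClass.coe_mul, hblock]
    refine bivector_mul_ne_zero (d := Finsupp.lapply (a, false)) (d' := Finsupp.lapply (b, true))
      ?_ ?_ ?_ (hcon a (by simp) false) (hcon b (by simp) true) hz <;> simp [pointVec]

/-- The realizations of the noncrossing matchings are linearly independent: cutting down to the
openers and closers of one matching `m` annihilates every other one, except some for which the
openers have a smaller sum. -/
theorem eq_zero_of_realizationMap_eq_zero {v : FamilySpace n} (hv : v ∈ NCMSpace n)
    (h : realizationMap n v = 0) : v = 0 := by
  refine eq_zero_of_triangular realization _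
    (fun m => (ExteriorAlgebra.map (cutMap (openers m) (closers m))).toLinearMap)
    (fun m => ∑ a ∈ openers m, ((a : ℕ) + 1)) ?_ ?_ v hv h
  · rintro m ⟨hm, -⟩
    rw [AlgHom.toLinearMap_apply, map_cutMap_realization]
    refine familyElement_cut_ne_zero hm fun e he => ?_
    obtain ⟨a, b, hab, rfl⟩ := exists_lt_of_card_eq_two (hm.1 e he)
    have ha : a ∈ openers m := mem_openers.2 ⟨b, hab, he⟩
    exact ⟨a, b, hab.ne, rfl, ha, mem_closers.2 ⟨a, hab, he⟩, hm.notMem_closers ha⟩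
  · rintro m ⟨hm, hnc⟩ m' ⟨hm', hnc'⟩ hne
    rw [AlgHom.toLinearMap_apply, map_cutMap_realization] at hne
    refine hm.eq_or_sum_openers_lt hm' hnc hnc' fun a b hab => ?_
    exact joins_of_familyElement_cut_ne_zero hm' (fun h0 => hne (by rw [h0]; rfl)) hab

end Matchings

/-! ### The matchings that pick one pair from each block -/

section Picks

variable {n : ℕ}

/-- The matchings picking one pair from each block are given by the choices of a pair from each
block. -/
theorem picksOnePair_iff {P m : SetFamily n}
    (hd : (P : Set (Finset (Fin n))).PairwiseDisjoint id) :
    PicksOnePair P m ↔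
      ∃ σ : Finset (Fin n) → Finset (Fin n), (∀ B ∈ P, σ B ⊆ B ∧ (σ B).card = 2) ∧
        m = P.image σ := by
  constructor
  · intro h
    have hex : ∀ B, ∃ e, B ∈ P → e ∈ m ∧ e ⊆ B := by
      intro B
      by_cases hB : B ∈ P
      · obtain ⟨e, he, -⟩ := h.2.2 B hB
        exact ⟨e, fun _ => he⟩
      · exact ⟨∅, fun h => absurd h hB⟩
    choose σ hσ using hex
    refine ⟨σ, fun B hB => ⟨(hσ B hB).2, h.1.1 _ (hσ B hB).1⟩, ?_⟩
    ext e
    rw [mem_image]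
    constructor
    · intro he
      obtain ⟨B, hB, heB⟩ := h.2.1 e he
      exact ⟨B, hB, (h.2.2 B hB).unique (hσ B hB) ⟨he, heB⟩⟩
    · rintro ⟨B, hB, rfl⟩
      exact (hσ B hB).1
  · rintro ⟨σ, hσ, rfl⟩
    refine ⟨⟨?_, ?_⟩, ?_, ?_⟩
    · intro e he
      obtain ⟨B, hB, rfl⟩ := mem_image.1 he
      exact (hσ B hB).2
    · intro e he f hf hne
      obtain ⟨B, hB, rfl⟩ := mem_image.1 he
      obtain ⟨C, hC, rfl⟩ := mem_image.1 hf
      exact (hd hB hC fun h => hne (by rw [h])).mono (hσ B hB).1 (hσ C hC).1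
    · intro e he
      obtain ⟨B, hB, rfl⟩ := mem_image.1 he
      exact ⟨B, hB, (hσ B hB).1⟩
    · intro B hB
      refine ⟨σ B, ⟨mem_image_of_mem σ hB, (hσ B hB).1⟩, ?_⟩
      rintro e ⟨he, heB⟩
      obtain ⟨C, hC, rfl⟩ := mem_image.1 he
      obtain ⟨z, hz⟩ := card_pos.1 (by rw [(hσ C hC).2]; exact Nat.two_pos : 0 < (σ C).card)
      rw [eq_of_mem_of_mem hd hC hB ((hσ C hC).1 hz) (heB hz)]

/-- A choice of a pair from each block is injective. -/
theorem injOn_of_choice {P : SetFamily n}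
    (hd : (P : Set (Finset (Fin n))).PairwiseDisjoint id) {σ : Finset (Fin n) → Finset (Fin n)}
    (hσ : ∀ B ∈ P, σ B ⊆ B ∧ (σ B).card = 2) : Set.InjOn σ P := by
  intro B hB C hC h
  obtain ⟨z, hz⟩ := card_pos.1 (by rw [(hσ B hB).2]; exact Nat.two_pos : 0 < (σ B).card)
  exact eq_of_mem_of_mem hd hB hC ((hσ B hB).1 hz) ((hσ C hC).1 (h ▸ hz))

theorem pairSum_apply (P m : SetFamily n) [Decidable (PicksOnePair P m)] :
    pairSum P m = if PicksOnePair P m then 1 else 0 := by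
  classical
  rw [pairSum, Finsupp.finsetSum_apply]
  simp only [basisVec, Finsupp.single_apply, sum_ite_eq', mem_filter, mem_univ, true_and]

theorem blockElement_eq_sum_pairs {M : Type*} [AddCommGroup M] [Module ℂ M] (x y : Fin n → M)
    (B : Finset (Fin n)) :
    blockElement x y B = ∑ e ∈ B.powersetCard 2, blockElement x y e := by
  unfold blockElement
  rw [← sum_fiberwise_of_maps_to (s := B.offDiag) (t := B.powersetCard 2)
    (g := fun p => ({p.1, p.2} : Finset (Fin n)))]
  · refine sum_congr rfl fun e he => sum_congr ?_ fun _ _ => rfl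
    rw [mem_powersetCard] at he
    ext ⟨a, b⟩
    simp only [mem_filter, mem_offDiag]
    constructor
    · rintro ⟨⟨-, -, hab⟩, rfl⟩
      simp [hab]
    · rintro ⟨ha, hb, hab⟩
      refine ⟨⟨he.1 ha, he.1 hb, hab⟩, eq_of_subset_of_card_le ?_ ?_⟩
      · simp [insert_subset_iff, ha, hb]
      · rw [he.2, card_pair hab]
  · rintro ⟨a, b⟩ h
    simp only [mem_offDiag, mem_powersetCard] at h ⊢
    exact ⟨by simp [insert_subset_iff, h.1, h.2.1], card_pair h.2.2⟩

/-- Expanding the product of the block elements over the pairs in each block gives the sum of the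
realizations of all matchings that pick one pair from each block. -/
theorem realizationMap_pairSum {P : SetFamily n}
    (hd : (P : Set (Finset (Fin n))).PairwiseDisjoint id) :
    realizationMap n (pairSum P) = realization P := by
  classical
  have key : familyElement (pointVec false) (pointVec true) P =
      ∑ m ∈ univ.filter (PicksOnePair P), familyElement (pointVec false) (pointVec true) m := by
    rw [familyElement, prod_congr rfl fun B _ => blockElement_eq_sum_pairs _ _ B, prod_sum]
    have hext : ∀ p ∈ P.pi fun B => B.powersetCard 2, ∀ B (hB : B ∈ P),
        (fun B => if h : B ∈ P then p B h else ∅) B = p B hB := fun p _ B hB => dif_pos hB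
    have hσ : ∀ p ∈ P.pi fun B => B.powersetCard 2, ∀ B ∈ P,
        (fun B => if h : B ∈ P then p B h else ∅) B ⊆ B ∧
          ((fun B => if h : B ∈ P then p B h else ∅) B).card = 2 := by
      intro p hp B hB
      rw [hext p hp B hB]
      exact mem_powersetCard.1 (mem_pi.1 hp B hB)
    refine sum_bij (fun p _ => P.image fun B => if h : B ∈ P then p B h else ∅) ?_ ?_ ?_ ?_
    · intro p hp
      rw [mem_filter]
      exact ⟨mem_univ _, (picksOnePair_iff hd).2 ⟨_, hσ p hp, rfl⟩⟩
    · intro p hp q hq hpq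
      funext B hB
      have h1 := (picksOnePair_iff hd).2 ⟨_, hσ p hp, rfl⟩
      refine (h1.2.2 B hB).unique ⟨?_, ?_⟩ ⟨?_, ?_⟩
      · rw [← hext p hp B hB]
        exact mem_image_of_mem _ hB
      · exact (mem_powersetCard.1 (mem_pi.1 hp B hB)).1
      · rw [hpq, ← hext q hq B hB]
        exact mem_image_of_mem _ hB
      · exact (mem_powersetCard.1 (mem_pi.1 hq B hB)).1
    · intro m hm
      obtain ⟨σ, hσ', rfl⟩ := (picksOnePair_iff hd).1 (mem_filter.1 hm).2
      refine ⟨fun B _ => σ B, mem_pi.2 fun B hB => mem_powersetCard.2 (hσ' B hB), ?_⟩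
      exact image_congr fun B hB => dif_pos hB
    · intro p hp
      rw [familyElement, prod_image (injOn_of_choice hd (hσ p hp)), ← prod_attach P]
      exact prod_congr rfl fun B _ => congrArg _ (hext p hp B.1 B.2).symm
  rw [pairSum, map_sum, realization, key, AddSubmonoidClass.coe_finsetSum]
  exact sum_congr rfl fun m _ => realizationMap_basisVec m

/-! ### Injectivity of the embedding -/

/-- The smallest and the largest element of a set. -/
def extremes (B : Finset (Fin n)) : Finset (Fin n) :=
  B.filter fun z => (∀ u ∈ B, z ≤ u) ∨ ∀ u ∈ B, u ≤ z

/-- The difference of the largest and the smallest element of a set. -/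
def width (B : Finset (Fin n)) : ℕ := (B ×ˢ B).sup fun p => (p.2 : ℕ) - p.1

/-- The matching that consists of the extreme pairs of the blocks. -/
def outline (P : SetFamily n) : SetFamily n := P.image extremes

theorem width_pair {a b : Fin n} (hab : a < b) : width {a, b} = b - a := by
  rw [Fin.lt_def] at hab
  apply le_antisymm
  · refine Finset.sup_le fun p hp => ?_
    simp only [mem_product, mem_insert, mem_singleton] at hp
    rcases hp with ⟨h1 | h1, h2 | h2⟩ <;> rw [h1, h2] <;> omega
  · exact le_sup (f := fun p : Fin n × Fin n => (p.2 : ℕ) - p.1) (b := (a, b)) (by simp)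

theorem width_mono {B C : Finset (Fin n)} (h : B ⊆ C) : width B ≤ width C :=
  sup_mono (product_subset_product h h)

theorem exists_extremes {B : Finset (Fin n)} (hB : 2 ≤ B.card) :
    ∃ a b, a < b ∧ a ∈ B ∧ b ∈ B ∧ (∀ z ∈ B, a ≤ z ∧ z ≤ b) ∧ extremes B = {a, b} ∧
      width B = b - a := by
  have hne : B.Nonempty := card_pos.1 (by omega)
  have hmin := fun z hz => B.min'_le z hz
  have hmax := fun z hz => B.le_max' z hz
  have ha := B.min'_mem hne
  have hb := B.max'_mem hne
  refine ⟨B.min' hne, B.max' hne, min'_lt_max'_of_card B hB, ha, hb,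
    fun z hz => ⟨hmin z hz, hmax z hz⟩, ?_, ?_⟩
  · ext z
    simp only [extremes, mem_filter, mem_insert, mem_singleton]
    constructor
    · rintro ⟨hz, h | h⟩
      · exact Or.inl (le_antisymm (h _ ha) (hmin z hz))
      · exact Or.inr (le_antisymm (hmax z hz) (h _ hb))
    · rintro (rfl | rfl)
      · exact ⟨ha, Or.inl hmin⟩
      · exact ⟨hb, Or.inr hmax⟩
  · apply le_antisymm
    · refine Finset.sup_le fun p hp => ?_
      rw [mem_product] at hp
      have h1 := hmin p.1 hp.1
      have h2 := hmax p.2 hp.2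
      simp only [Fin.le_def] at h1 h2
      omega
    · exact le_sup (f := fun p : Fin n × Fin n => (p.2 : ℕ) - p.1)
        (b := (B.min' hne, B.max' hne)) (mem_product.2 ⟨ha, hb⟩)

theorem extremes_subset (B : Finset (Fin n)) : extremes B ⊆ B := filter_subset _ _

theorem card_extremes {B : Finset (Fin n)} (hB : 2 ≤ B.card) : (extremes B).card = 2 := by
  obtain ⟨a, b, hab, -, -, -, h, -⟩ := exists_extremes hB
  rw [h, card_pair hab.ne]

theorem width_extremes {B : Finset (Fin n)} (hB : 2 ≤ B.card) : width (extremes B) = width B := by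
  obtain ⟨a, b, hab, -, -, -, h, h'⟩ := exists_extremes hB
  rw [h, h', width_pair hab]

theorem eq_extremes_of_width {B e : Finset (Fin n)} (hB : 2 ≤ B.card) (he : e.card = 2)
    (heB : e ⊆ B) (h : width e = width B) : e = extremes B := by
  obtain ⟨a, b, hab, -, -, hmm, h1, h2⟩ := exists_extremes hB
  obtain ⟨c, d, hcd, rfl⟩ := exists_lt_of_card_eq_two he
  rw [width_pair hcd, h2] at h
  have hc := hmm c (heB (by simp))
  have hd := hmm d (heB (by simp))
  simp only [Fin.lt_def, Fin.le_def] at hc hd hab hcd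
  have e1 : c = a := Fin.ext (by omega)
  have e2 : d = b := Fin.ext (by omega)
  rw [h1, e1, e2]

theorem two_le_card_of_mem {P : SetFamily n} (hP : IsSetPartition P) (hs : SingletonFree P)
    {B : Finset (Fin n)} (hB : B ∈ P) : 2 ≤ B.card := by
  have h1 := hs B hB
  have h0 : B.card ≠ 0 := fun h => (isSetPartition_iff.1 hP).1 (card_eq_zero.1 h ▸ hB)
  omega

theorem picksOnePair_outline {P : SetFamily n} (hP : IsSetPartition P) (hs : SingletonFree P) :
    PicksOnePair P (outline P) :=
  (picksOnePair_iff (isSetPartition_iff.1 hP).2.1).2 ⟨extremes, fun B hB =>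
    ⟨extremes_subset B, card_extremes (two_le_card_of_mem hP hs hB)⟩, rfl⟩

/-- Among the matchings that pick one pair from each block, the outline is the widest. -/
theorem eq_outline_or_sum_width_lt {P m : SetFamily n} (hP : IsSetPartition P)
    (hs : SingletonFree P) (h : PicksOnePair P m) :
    m = outline P ∨ ∑ e ∈ m, width e < ∑ e ∈ outline P, width e := by
  have hd := (isSetPartition_iff.1 hP).2.1
  obtain ⟨σ, hσ, rfl⟩ := (picksOnePair_iff hd).1 h
  have hout : ∑ e ∈ outline P, width e = ∑ B ∈ P, width B := by
    rw [outline, sum_image (injOn_of_choice hd fun B hB =>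
      ⟨extremes_subset B, card_extremes (two_le_card_of_mem hP hs hB)⟩)]
    exact sum_congr rfl fun B hB => width_extremes (two_le_card_of_mem hP hs hB)
  rw [hout, sum_image (injOn_of_choice hd hσ)]
  have hle : ∀ B ∈ P, width (σ B) ≤ width B := fun B hB => width_mono (hσ B hB).1
  rcases (sum_le_sum hle).lt_or_eq with hlt | heq
  · exact Or.inr hlt
  · left
    have := (sum_eq_sum_iff_of_le hle).1 heq
    exact image_congr fun B hB => eq_extremes_of_width (two_le_card_of_mem hP hs hB) (hσ B hB).2
      (hσ B hB).1 (this B hB)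

/-- If the outlines of two noncrossing partitions agree, then blocks with the same extremes agree. A
point of `B` in another block `D ≠ C` of `Q` would put the extremes of `D` between those of `C`,
since `Q` is noncrossing, and the extremes of `B` between those of `D`, since `P` is noncrossing. -/
theorem subset_of_extremes_eq {P Q : SetFamily n} (hP : IsSetPartition P) (hPn : Noncrossing P)
    (hPs : SingletonFree P) (hQ : IsSetPartition Q) (hQn : Noncrossing Q) (hQs : SingletonFree Q)
    (h : outline P = outline Q) {B C : Finset (Fin n)} (hB : B ∈ P) (hC : C ∈ Q)
    (hBC : extremes B = extremes C) : B ⊆ C := by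
  have hPd := (isSetPartition_iff.1 hP).2.1
  have hQd := (isSetPartition_iff.1 hQ).2.1
  intro x hx
  obtain ⟨a, b, hab, ha, hb, hmm, hB', -⟩ := exists_extremes (two_le_card_of_mem hP hPs hB)
  have haC : a ∈ C := extremes_subset C (hBC ▸ hB' ▸ by simp)
  have hbC : b ∈ C := extremes_subset C (hBC ▸ hB' ▸ by simp)
  by_contra hxC
  obtain ⟨D, hD, hxD⟩ := (isSetPartition_iff.1 hQ).2.2 x
  have hDC : D ≠ C := fun e => hxC (e ▸ hxD)
  obtain ⟨E, hE, hED⟩ : ∃ E ∈ P, extremes E = extremes D := by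
    have : extremes D ∈ outline P := h ▸ mem_image_of_mem _ hD
    exact mem_image.1 this
  obtain ⟨c, d, hcd, hc, hd, hmm', hD', -⟩ := exists_extremes (two_le_card_of_mem hQ hQs hD)
  have hcE : c ∈ E := extremes_subset E (hED ▸ hD' ▸ by simp)
  have hdE : d ∈ E := extremes_subset E (hED ▸ hD' ▸ by simp)
  have hEB : E ≠ B := by
    rintro rfl
    have hac : a ∈ extremes D := hED ▸ hB' ▸ by simp
    exact hDC (eq_of_mem_of_mem hQd hD hC (extremes_subset D hac) haC)
  have hne : ∀ z ∈ E, x ≠ z := fun z hz e => hEB (eq_of_mem_of_mem hPd hE hB hz (e ▸ hx))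
  have hne' : ∀ z ∈ C, x ≠ z := fun z hz e => hxC (e ▸ hz)
  have h1 := ((noncrossing_iff hQd).1 hQn D hD C hC hDC a haC b hbC x hxD c hc
    (lt_of_le_of_ne (hmm x hx).1 (hne' a haC).symm) (lt_of_le_of_ne (hmm x hx).2 (hne' b hbC))).1
  have h2 := ((noncrossing_iff hPd).1 hPn B hB E hE hEB.symm c hcE d hdE x hx a ha
    (lt_of_le_of_ne (hmm' x hxD).1 (hne c hcE).symm)
    (lt_of_le_of_ne (hmm' x hxD).2 (hne d hdE))).1
  exact lt_asymm h1 h2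

theorem subset_of_outline_eq {P Q : SetFamily n} (hP : IsSetPartition P) (hPn : Noncrossing P)
    (hPs : SingletonFree P) (hQ : IsSetPartition Q) (hQn : Noncrossing Q) (hQs : SingletonFree Q)
    (h : outline P = outline Q) : P ⊆ Q := by
  intro B hB
  have : extremes B ∈ outline Q := h ▸ mem_image_of_mem _ hB
  obtain ⟨C, hC, hCB⟩ := mem_image.1 this
  have e : B = C := subset_antisymm
    (subset_of_extremes_eq hP hPn hPs hQ hQn hQs h hB hC hCB.symm)
    (subset_of_extremes_eq hQ hQn hQs hP hPn hPs h.symm hC hB hCB)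
  exact e ▸ hC

theorem eq_zero_of_pairSum_eq_zero {v : FamilySpace n} (hv : v ∈ NCPZeroSpace n)
    (h : Finsupp.linearCombination ℂ (pairSum (n := n)) v = 0) : v = 0 := by
  classical
  refine eq_zero_of_triangular pairSum _ (fun P => Finsupp.lapply (outline P))
    (fun P => -((∑ e ∈ outline P, width e : ℕ) : ℤ)) ?_ ?_ v hv h
  · rintro P ⟨hP, -, hPs⟩
    rw [Finsupp.lapply_apply, pairSum_apply, if_pos (picksOnePair_outline hP hPs)]
    exact one_ne_zero
  · rintro P ⟨hP, hPn, hPs⟩ Q ⟨hQ, hQn, hQs⟩ hne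
    rw [Finsupp.lapply_apply, pairSum_apply, ne_eq, ite_eq_right_iff, not_forall] at hne
    rcases eq_outline_or_sum_width_lt hQ hQs hne.1 with e | hlt
    · exact Or.inl (subset_antisymm (subset_of_outline_eq hQ hQn hQs hP hPn hPs e.symm)
        (subset_of_outline_eq hP hPn hPs hQ hQn hQs e))
    · exact Or.inr (by omega)

end Picks

/-! ### Transport of the action to the spans -/

section Transport

variable {n : ℕ}

theorem closure_adjacent_swaps (n : ℕ) :
    Submonoid.closure {w : Perm (Fin n) | ∃ x y : Fin n, (y : ℕ) = x + 1 ∧ w = swap x y} = ⊤ := by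
  cases n with
  | zero => exact Subsingleton.elim _ _
  | succ n =>
    rw [eq_top_iff, ← Perm.mclosure_swap_castSucc_succ n]
    refine Submonoid.closure_mono ?_
    rintro _ ⟨i, rfl⟩
    exact ⟨i.castSucc, i.succ, by simp, rfl⟩

/-- To prove a multiplicative property of all permutations it suffices to check the adjacent
transpositions. -/
theorem perm_induction {motive : Perm (Fin n) → Prop}
    (swap : ∀ x y : Fin n, (y : ℕ) = x + 1 → motive (swap x y)) (one : motive 1)
    (mul : ∀ v w, motive v → motive w → motive (v * w)) (w : Perm (Fin n)) : motive w := by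
  have hw : w ∈ Submonoid.closure
      {w : Perm (Fin n) | ∃ x y : Fin n, (y : ℕ) = x + 1 ∧ w = Equiv.swap x y} := by
    rw [closure_adjacent_swaps]
    exact Submonoid.mem_top w
  induction hw using Submonoid.closure_induction with
  | mem w hw =>
    obtain ⟨x, y, hxy, rfl⟩ := hw
    exact swap x y hxy
  | one => exact one
  | mul v w _ _ hv hw => exact mul v w hv hw

variable {S : Set (SetFamily n)} {step : Fin n → Fin n → SetFamily n → FamilySpace n}

theorem realizationMap_linearCombination
    (hstep : ∀ x y : Fin n, (y : ℕ) = x + 1 → ∀ P ∈ S,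
      realizationMap n (step x y P) = pointRep n (swap x y) (realization P))
    {x y : Fin n} (hxy : (y : ℕ) = x + 1) {v : FamilySpace n}
    (hv : v ∈ Finsupp.supported ℂ ℂ S) :
    realizationMap n (Finsupp.linearCombination ℂ (step x y) v) =
      pointRep n (swap x y) (realizationMap n v) := by
  rw [realizationMap_apply v, Finsupp.linearCombination_apply, Finsupp.sum, map_sum, map_sum]
  refine sum_congr rfl fun P hP => ?_
  rw [map_smul, map_smul]
  exact congrArg _ (hstep x y hxy P ((Finsupp.mem_supported ℂ v).1 hv hP))

/-- A representation in which the adjacent transpositions act by a rule that is realized in the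
exterior algebra is intertwined with the action on the exterior algebra. -/
theorem realizationMap_intertwines
    (hstep : ∀ x y : Fin n, (y : ℕ) = x + 1 → ∀ P ∈ S,
      realizationMap n (step x y P) = pointRep n (swap x y) (realization P))
    (ρ : Representation ℂ (Perm (Fin n)) (Finsupp.supported ℂ ℂ S))
    (hρ : ∀ x y : Fin n, (y : ℕ) = x + 1 → ∀ v : Finsupp.supported ℂ ℂ S,
      (ρ (swap x y) v : FamilySpace n) =
        Finsupp.linearCombination ℂ (step x y) (v : FamilySpace n))
    (w : Perm (Fin n)) (v : Finsupp.supported ℂ ℂ S) :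
    realizationMap n (ρ w v) = pointRep n w (realizationMap n v) := by
  induction w using perm_induction generalizing v with
  | swap x y hxy =>
    rw [hρ x y hxy]
    exact realizationMap_linearCombination hstep hxy v.2
  | one => simp
  | mul w w' h h' => rw [map_mul, map_mul, Module.End.mul_apply, Module.End.mul_apply, h, h']

/-- If the realizations of the families in `S` are independent, and a rule for the adjacent
transpositions preserves the span of `S` and is realized in the exterior algebra, then it defines
exactly one representation on this span. -/
theorem existsUnique_representation
    (hinj : ∀ v ∈ Finsupp.supported ℂ ℂ S, realizationMap n v = 0 → v = 0)
    (hmem : ∀ x y : Fin n, (y : ℕ) = x + 1 → ∀ P ∈ S, step x y P ∈ Finsupp.supported ℂ ℂ S)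
    (hstep : ∀ x y : Fin n, (y : ℕ) = x + 1 → ∀ P ∈ S,
      realizationMap n (step x y P) = pointRep n (swap x y) (realization P)) :
    ∃! ρ : Representation ℂ (Perm (Fin n)) (Finsupp.supported ℂ ℂ S),
      ∀ x y : Fin n, (y : ℕ) = x + 1 → ∀ v : Finsupp.supported ℂ ℂ S,
        (ρ (swap x y) v : FamilySpace n) =
          Finsupp.linearCombination ℂ (step x y) (v : FamilySpace n) := by
  have hinj' : ∀ u v : Finsupp.supported ℂ ℂ S,
      realizationMap n u = realizationMap n v → u = v := by
    intro u v h
    refine Subtype.ext (sub_eq_zero.1 (hinj _ (Submodule.sub_mem _ u.2 v.2) ?_))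
    rw [map_sub, h, sub_self]
  have hex : ∀ w : Perm (Fin n), ∃ L : Module.End ℂ (Finsupp.supported ℂ ℂ S),
      ∀ v, realizationMap n (L v) = pointRep n w (realizationMap n v) := by
    intro w
    induction w using perm_induction with
    | swap x y hxy =>
      refine ⟨(Finsupp.linearCombination ℂ (step x y)).restrict fun v hv => ?_, fun v => ?_⟩
      · rw [Finsupp.linearCombination_apply]
        exact Submodule.sum_mem _ fun P hP => Submodule.smul_mem _ _
          (hmem x y hxy P ((Finsupp.mem_supported ℂ v).1 hv hP))
      · exact realizationMap_linearCombination hstep hxy v.2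
    | one => exact ⟨1, fun v => by simp⟩
    | mul w w' h h' =>
      obtain ⟨L, hL⟩ := h
      obtain ⟨L', hL'⟩ := h'
      exact ⟨L * L', fun v => by rw [Module.End.mul_apply, hL, hL', map_mul, Module.End.mul_apply]⟩
  choose L hL using hex
  refine ⟨⟨⟨L, LinearMap.ext fun v => hinj' _ _ ?_⟩, fun w w' => LinearMap.ext fun v =>
    hinj' _ _ ?_⟩, fun x y hxy v => ?_, fun ρ hρ => ?_⟩
  · rw [hL, map_one, Module.End.one_apply, Module.End.one_apply]
  · change realizationMap n (L (w * w') v) = realizationMap n ((L w * L w') v)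
    rw [hL, map_mul, Module.End.mul_apply, Module.End.mul_apply, hL, hL]
  · change ((L (swap x y) v : Finsupp.supported ℂ ℂ S) : FamilySpace n) = _
    have h1 : Finsupp.linearCombination ℂ (step x y) (v : FamilySpace n) ∈
        Finsupp.supported ℂ ℂ S := by
      rw [Finsupp.linearCombination_apply]
      exact Submodule.sum_mem _ fun P hP => Submodule.smul_mem _ _
        (hmem x y hxy P ((Finsupp.mem_supported ℂ _).1 v.2 hP))
    exact congrArg Subtype.val (hinj' (L (swap x y) v) ⟨_, h1⟩
      ((hL _ _).trans (realizationMap_linearCombination hstep hxy v.2).symm))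
  · refine MonoidHom.ext fun w => LinearMap.ext fun v => hinj' _ _ ?_
    exact (realizationMap_intertwines hstep ρ hρ w v).trans (hL w v).symm

theorem realizationMap_skeinEmbedding (v : NCPZeroSpace n) :
    realizationMap n (skeinEmbedding n v) = realizationMap n v := by
  change realizationMap n (Finsupp.linearCombination ℂ pairSum (v : FamilySpace n)) = _
  rw [realizationMap_apply (v : FamilySpace n), Finsupp.linearCombination_apply, Finsupp.sum,
    map_sum]
  refine sum_congr rfl fun P hP => ?_
  have hP' := (Finsupp.mem_supported ℂ _).1 v.2 hP
  rw [map_smul, realizationMap_pairSum (isSetPartition_iff.1 hP'.1).2.1]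

theorem skeinEmbedding_injective (n : ℕ) : Function.Injective (skeinEmbedding n) := by
  intro u v h
  refine Subtype.ext (sub_eq_zero.1 (eq_zero_of_pairSum_eq_zero (Submodule.sub_mem _ u.2 v.2) ?_))
  rw [map_sub, sub_eq_zero]
  exact congrArg Subtype.val h

end Transport

theorem theorem3 (n : ℕ) :
    (∃! ρ : Representation ℂ (Equiv.Perm (Fin n)) (NCPZeroSpace n), IsSkeinAction ρ) ∧
    (∃! τ : Representation ℂ (Equiv.Perm (Fin n)) (NCMSpace n), IsPtolemyAction τ) ∧
    Function.Injective (skeinEmbedding n) ∧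
    ∀ (ρ : Representation ℂ (Equiv.Perm (Fin n)) (NCPZeroSpace n))
      (τ : Representation ℂ (Equiv.Perm (Fin n)) (NCMSpace n)),
      IsSkeinAction ρ → IsPtolemyAction τ →
        ∀ (w : Equiv.Perm (Fin n)) (v : NCPZeroSpace n),
          skeinEmbedding n (ρ w v) = τ w (skeinEmbedding n v) := by
  have hM : ∀ v ∈ NCMSpace n, realizationMap n v = 0 → v = 0 := fun v hv h =>
    eq_zero_of_realizationMap_eq_zero hv h
  have hP : ∀ v ∈ NCPZeroSpace n, realizationMap n v = 0 → v = 0 := by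
    intro v hv h
    have h1 : skeinEmbedding n ⟨v, hv⟩ = 0 := Subtype.ext (hM _ (skeinEmbedding n ⟨v, hv⟩).2
      ((realizationMap_skeinEmbedding ⟨v, hv⟩).trans h))
    exact congrArg Subtype.val (skeinEmbedding_injective n (h1.trans (map_zero _).symm))
  refine ⟨?_, ?_, skeinEmbedding_injective n, fun ρ τ hρ hτ w v => ?_⟩
  · exact existsUnique_representation hP (fun x y hxy P hP => skeinStep_mem hxy hP)
      fun x y hxy P hP => skeinStep_realization hxy hP.1 hP.2.2
  · exact existsUnique_representation hM (fun x y hxy m hm => ptolemyStep_mem hxy hm.1 hm.2)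
      fun x y hxy m hm => ptolemyStep_realization hxy hm.1 hm.2
  · have h1 := realizationMap_intertwines (S := {P | IsSetPartition P ∧ Noncrossing P ∧
      SingletonFree P}) (fun x y hxy P hP => skeinStep_realization hxy hP.1 hP.2.2) ρ hρ w v
    have h2 := realizationMap_intertwines (S := {m | IsMatching m ∧ Noncrossing m})
      (fun x y hxy m hm => ptolemyStep_realization hxy hm.1 hm.2) τ hτ w (skeinEmbedding n v)
    refine Subtype.ext (sub_eq_zero.1 (hM _ (Submodule.sub_mem _
      (skeinEmbedding n (ρ w v)).2 (τ w (skeinEmbedding n v)).2) ?_))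
    rw [map_sub, sub_eq_zero, realizationMap_skeinEmbedding]
    refine h1.trans (Eq.trans ?_ h2.symm)
    rw [realizationMap_skeinEmbedding]
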